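/- A \emph{triple system} consists of a set $V$ of points and a finite set $\mathcal B$ of $3$-element subsets of $V$, called blocks. A \emph{configuration} is a triple system in which every pair of distinct points is contained in at most one block and every point is contained in at least one block. A \emph{Steiner triple system} of order $n$, STS$(n)$, is a triple system on $n$ points in which every pair of distinct points is contained in exactly one block. A triple system $D$ \emph{contains} a triple system $C$ if some injection of the points of $C$ into the points of $D$ maps every block of $C$ onto a block of $D$; the image is called a copy of $C$. A configuration $C$ is \emph{unavoidable} if there is an $n_0=n_0(C)$ such that every STS$(n)$ with $n\ge n_0$ contains $C$. For an integer $t\ge 1$, $C$ is \emph{$t$-Ramsey} if there is an $n_0=n_0(C,t)$ such that for every $n\ge n_0$ and every STS$(n)$, every coloring of its blocks with $t$ colors has a monochromatic copy of $C$, that is, a copy all of whose blocks have the same color. The \emph{sail} $C_{15}$ is the configuration on the points $1,\dots,7$ with blocks $\{1,2,3\}$, $\{3,4,5\}$, $\{5,6,1\}$, $\{1,4,7\}$. \textbf{Theorem.} Every unavoidable configuration with at most $5$ blocks that does not contain the sail is $t$-Ramsey for every integer $t\ge 1$. -/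

import Mathlib

/-- A triple system on the point set `V`: a finite set of 3-element subsets of `V`, the blocks. -/
structure TripleSystem (V : Type*) where
  blocks : Finset (Finset V)
  card_block : ∀ B ∈ blocks, B.card = 3

namespace TripleSystem

/-- A configuration (partial Steiner triple system): every pair of distinct points is contained in
at most one block, and every point is contained in at least one block. -/
structure IsConfiguration {V : Type*} (C : TripleSystem V) : Prop where
  pair_unique : ∀ x y : V, x ≠ y → ∀ B₁ ∈ C.blocks, ∀ B₂ ∈ C.blocks,
    x ∈ B₁ → y ∈ B₁ → x ∈ B₂ → y ∈ B₂ → B₁ = B₂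
  covered : ∀ x : V, ∃ B ∈ C.blocks, x ∈ B

/-- A Steiner triple system: every pair of distinct points is contained in exactly one block. -/
def IsSteiner {W : Type*} (S : TripleSystem W) : Prop :=
  ∀ x y : W, x ≠ y → ∃! B : Finset W, B ∈ S.blocks ∧ x ∈ B ∧ y ∈ B

/-- `D` contains (a copy of) `C` as a subsystem, not necessarily an induced one: some injection of
the points of `C` into those of `D` maps every block of `C` onto a block of `D`. -/
def Contains {W V : Type*} (D : TripleSystem W) (C : TripleSystem V) : Prop :=
  ∃ f : V ↪ W, ∀ B ∈ C.blocks, B.map f ∈ D.blocks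

/-- `C` is unavoidable: every Steiner triple system with sufficiently many points contains `C`. -/
def Unavoidable {V : Type*} (C : TripleSystem V) : Prop :=
  ∃ n₀ : ℕ, ∀ n ≥ n₀, ∀ (W : Type) [Fintype W], Fintype.card W = n →
    ∀ S : TripleSystem W, S.IsSteiner → S.Contains C

/-- `C` is `t`-Ramsey: for all sufficiently large `n`, every colouring of the blocks of any Steiner
triple system on `n` points with `t` colours has a copy of `C` all of whose blocks have the same
colour. -/
def IsRamsey {V : Type*} (C : TripleSystem V) (t : ℕ) : Prop :=
  ∃ n₀ : ℕ, ∀ n ≥ n₀, ∀ (W : Type) [Fintype W], Fintype.card W = n →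
    ∀ S : TripleSystem W, S.IsSteiner → ∀ c : {B : Finset W // B ∈ S.blocks} → Fin t,
      ∃ (i : Fin t) (f : V ↪ W), ∀ B ∈ C.blocks, ∃ h : B.map f ∈ S.blocks, c ⟨B.map f, h⟩ = i

/-- The sail: blocks 123, 345, 561, 147 on the points 1, …, 7, with point `k` written as `k - 1`. -/
def sail : TripleSystem (Fin 7) where
  blocks := {{0, 1, 2}, {2, 3, 4}, {4, 5, 0}, {0, 3, 6}}
  card_block := by
    intro B hB
    simp only [Finset.mem_insert, Finset.mem_singleton] at hB
    rcases hB with rfl | rfl | rfl | rfl <;> rfl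

end TripleSystem

/-!
The argument is one of density. The most frequent colour class of a Steiner triple system on `n`
points contains a positive proportion of all `n (n - 1) / 6` blocks, so it suffices to embed the
configuration into every dense linear family of triples (`IsDenseUnavoidable`).

*Which configurations occur.* Call a block of the configuration removable if it meets the other
blocks in at most one point. After discarding points of small degree from the dense family, a
removed block can always be reattached (`IsDenseUnavoidable.of_erase`), so only configurations
without removable blocks (`IsCore`) matter. Unavoidability is used only to exclude a block joining
two non-corner points of a triangle: it would have to embed into the Steiner triple systems of the
points of projective spaces over `ZMod 2` and of affine spaces over `ZMod 3`, where the resulting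
linear equations are contradictory (`not_isBlock_sides_of_unavoidable`). A block joining a corner
of a triangle to the opposite point is a sail. Hence every further block meets a triangle in at
most one point (`TriangleSparse`), and the cores with at most five blocks are: a triangle; a
triangle with two of its six points joined by a path of two blocks; the cycles of four and five
blocks; and two disjoint blocks joined by three blocks (the ladder).

*Finding them in a dense family.* The tool is triangle removal in the following form
(`exists_card_crossTriples_ge`): if `T` is a dense set of triples in which two coordinates
determine the third, then a positive proportion of all triples `(x, y, z)` have each of their three
pairs of coordinates in common with some member of `T`. Since two points with many common
neighbours can be joined by a path avoiding any bounded set (`exists_path_avoiding`), a triangle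
with a path needs only a triangle in which the two relevant points have many common neighbours.

* For two points on a common block, almost all blocks have this property for all their pairs, for
  otherwise the triangles through a pair with few common neighbours would be too few
  (`exists_card_poor_le`); triangle removal is then applied to the remaining blocks.
* For a corner and the opposite point, a triangle violating the property is determined up to
  boundedly many choices by these two points (`exists_triangle_corner_opposite`).
* For two non-corner points, triangle removal is applied, for each point `w`, to the blocks
  `{v, a, b}` with `a` and `b` adjacent to `w`. There are many such blocks for many `w`, because
  they correspond to the triangles with `w` as a corner, and a cross triple is a triangle two of
  whose non-corner points are adjacent to `w` (`exists_triangle_sides`).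

For the ladder, fix a point `g` and consider the blocks `{x, y, z}` such that `y` is adjacent to
`g` and `z` to the third point of the block through `g` and `y`. Again these correspond to
triangles, so there are many for some `g`; a cross triple `(x, z, y')` of the triples `(x, z, y)`
yields the ladder with blocks `{x, y, z}` and `{x', y', g}` (`exists_ladder`).
-/

/-! ### Triangle removal for sets of triples -/

open Classical in
/-- The triples all of whose three pairs of coordinates are the corresponding pair of
coordinates of some member of `T`. -/
noncomputable def crossTriples {W : Type} [Fintype W] (T : Finset (W × W × W)) :
    Finset (W × W × W) :=
  Finset.univ.filter fun x =>
    (∃ c, (x.1, x.2.1, c) ∈ T) ∧ (∃ b, (x.1, b, x.2.2) ∈ T) ∧ ∃ a, (a, x.2.1, x.2.2) ∈ T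

theorem mem_crossTriples {W : Type} [Fintype W] {T : Finset (W × W × W)} {x y z : W} :
    (x, y, z) ∈ crossTriples T ↔
      (∃ c, (x, y, c) ∈ T) ∧ (∃ b, (x, b, z) ∈ T) ∧ ∃ a, (a, y, z) ∈ T := by
  simp [crossTriples]

/-- The form of the triangle removal lemma on which everything rests: a dense set of triples in
which any two coordinates determine the third gives a positive proportion of all triples as
cross triples. -/
theorem exists_card_crossTriples_ge {ε : ℝ} (hε : 0 < ε) :
    ∃ c : ℝ, 0 < c ∧ ∀ (W : Type) [Fintype W] (T : Finset (W × W × W)),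
      SimpleGraph.TripartiteFromTriangles.ExplicitDisjoint T →
      ε * (Fintype.card W : ℝ) ^ 2 ≤ T.card →
      c * (Fintype.card W : ℝ) ^ 3 ≤ (crossTriples T).card := by
  classical
  -- The graph lives on three copies of `W`, whence the factors `9` and `27`.
  have hε' : 0 < ε / 9 := by positivity
  refine ⟨SimpleGraph.triangleRemovalBound (ε / 9) * 27,
    mul_pos (SimpleGraph.triangleRemovalBound_pos hε') (by norm_num), ?_⟩
  intro W _ T hT hcard
  have hfar : (SimpleGraph.TripartiteFromTriangles.graph T).FarFromTriangleFree
      (ε / 9) := by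
    apply SimpleGraph.TripartiteFromTriangles.farFromTriangleFree
    refine le_trans ?_ hcard
    push_cast
    exact le_of_eq (by ring)
  have h := hfar.le_card_cliqueFinset
  have hle : ((SimpleGraph.TripartiteFromTriangles.graph T).cliqueFinset 3).card ≤
      (crossTriples T).card := by
    refine le_trans (Finset.card_le_card ?_)
      (Finset.card_image_le
        (f := fun x => SimpleGraph.TripartiteFromTriangles.toTriangle (α := W) (β := W) (γ := W) x))
    intro s hs
    rw [SimpleGraph.mem_cliqueFinset_iff, SimpleGraph.is3Clique_iff] at hs
    obtain ⟨u, v, w, huv, huw, hvw, rfl⟩ := hs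
    obtain ⟨a, b, c, habc, hab, hac, hbc⟩ :=
      SimpleGraph.TripartiteFromTriangles.graph_triple huv huw hvw
    rw [Finset.mem_image]
    refine ⟨(a, b, c), mem_crossTriples.2 ⟨?_, ?_, ?_⟩, habc⟩
    · exact SimpleGraph.TripartiteFromTriangles.Graph.in₀₁_iff.1 hab
    · exact SimpleGraph.TripartiteFromTriangles.Graph.in₀₂_iff.1 hac
    · exact SimpleGraph.TripartiteFromTriangles.Graph.in₁₂_iff.1 hbc
  refine le_trans (le_of_eq ?_) (h.trans (Nat.cast_le.2 hle))
  simp only [Fintype.card_sum]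
  push_cast
  ring

/-- A set of triples whose last entry is, up to reordering, confined to a set of at most `K`
values determined by the other two has at most `K n ^ 2` members. -/
theorem card_triples_le {W : Type} [Fintype W] [DecidableEq W] {K : ℕ} (S : Finset (W × W × W))
    (g : W × W × W → W × W × W) (F : W → W → Finset W) (hF : ∀ x y, (F x y).card ≤ K)
    (hg : ∀ x ∈ S, ∃ a b c, c ∈ F a b ∧ g (a, b, c) = x) :
    S.card ≤ K * Fintype.card W ^ 2 := by
  let P : Finset (W × W × W) :=
    (Finset.univ : Finset (W × W)).biUnion fun p => (F p.1 p.2).image fun c => (p.1, p.2, c)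
  have hP : P.card ≤ Fintype.card W ^ 2 * K := by
    refine (Finset.card_biUnion_le_card_mul _ _ K
      fun p _ => Finset.card_image_le.trans (hF _ _)).trans (le_of_eq ?_)
    simp [sq]
  have hS : S ⊆ P.image g := by
    intro x hx
    obtain ⟨a, b, c, hc, rfl⟩ := hg x hx
    refine Finset.mem_image_of_mem _ (Finset.mem_biUnion.2 ⟨(a, b), Finset.mem_univ _, ?_⟩)
    exact Finset.mem_image_of_mem _ hc
  calc S.card ≤ (P.image g).card := Finset.card_le_card hS
    _ ≤ P.card := Finset.card_image_le
    _ ≤ _ := by rw [mul_comm]; exact hP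

/-! ### Linear families of triples -/

/-- A linear family of triples: all members have three points, and two points lie together in at
most one member. -/
structure IsLinearFamily {W : Type*} (H : Finset (Finset W)) : Prop where
  card_eq : ∀ B ∈ H, B.card = 3
  eq_of_mem : ∀ x y : W, x ≠ y → ∀ B₁ ∈ H, ∀ B₂ ∈ H, x ∈ B₁ → y ∈ B₁ → x ∈ B₂ → y ∈ B₂ → B₁ = B₂

/-- `IsBlock H x y z`: the points `x, y, z` are distinct and form a member of `H`. -/
def IsBlock {W : Type*} (H : Finset (Finset W)) (x y z : W) : Prop :=
  x ≠ y ∧ y ≠ z ∧ x ≠ z ∧ ∃ B ∈ H, x ∈ B ∧ y ∈ B ∧ z ∈ B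

/-- Two points are adjacent if some member of `H` contains both. -/
def BlockAdj {W : Type*} (H : Finset (Finset W)) (x y : W) : Prop := ∃ z, IsBlock H x y z

open Classical in
/-- The common neighbours of `x` and `y` for the relation `BlockAdj`. -/
noncomputable def commonNbrs {W : Type} [Fintype W] (H : Finset (Finset W)) (x y : W) : Finset W :=
  Finset.univ.filter fun w => BlockAdj H x w ∧ BlockAdj H y w

open Classical in
/-- The third point of the block through `x` and `y`, with the junk value `x` if there is none. -/
noncomputable def third {W : Type*} (H : Finset (Finset W)) (x y : W) : W :=
  if h : BlockAdj H x y then h.choose else x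

section Basic

variable {W : Type*} {H : Finset (Finset W)} {x y z w : W}

theorem IsBlock.rot (h : IsBlock H x y z) : IsBlock H y z x := by
  obtain ⟨h1, h2, h3, B, hB, hx, hy, hz⟩ := h
  exact ⟨h2, h3.symm, h1.symm, B, hB, hy, hz, hx⟩

theorem IsBlock.swap (h : IsBlock H x y z) : IsBlock H y x z := by
  obtain ⟨h1, h2, h3, B, hB, hx, hy, hz⟩ := h
  exact ⟨h1.symm, h3, h2, B, hB, hy, hx, hz⟩

theorem IsBlock.swap_right (h : IsBlock H x y z) : IsBlock H x z y := h.rot.rot.swap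

theorem IsBlock.mono {H' : Finset (Finset W)} (hs : H ⊆ H') (h : IsBlock H x y z) :
    IsBlock H' x y z := by
  obtain ⟨h1, h2, h3, B, hB, hx, hy, hz⟩ := h
  exact ⟨h1, h2, h3, B, hs hB, hx, hy, hz⟩

theorem IsLinearFamily.mono {H' : Finset (Finset W)} (hs : H ⊆ H') (h : IsLinearFamily H') :
    IsLinearFamily H :=
  ⟨fun B hB => h.card_eq B (hs hB), fun x y hxy B₁ h₁ B₂ h₂ =>
    h.eq_of_mem x y hxy B₁ (hs h₁) B₂ (hs h₂)⟩

theorem IsLinearFamily.mem_iff (hH : IsLinearFamily H) {B : Finset W} (hB : B ∈ H)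
    (hxy : x ≠ y) (hyz : y ≠ z) (hxz : x ≠ z) (hx : x ∈ B) (hy : y ∈ B) (hz : z ∈ B) (v : W) :
    v ∈ B ↔ v = x ∨ v = y ∨ v = z := by
  classical
  have hsub : ({x, y, z} : Finset W) ⊆ B := by
    intro u hu
    simp only [Finset.mem_insert, Finset.mem_singleton] at hu
    rcases hu with rfl | rfl | rfl <;> assumption
  have hc : ({x, y, z} : Finset W).card = 3 := Finset.card_eq_three.2 ⟨x, y, z, hxy, hxz, hyz, rfl⟩
  have := Finset.eq_of_subset_of_card_le hsub (by rw [hc, hH.card_eq B hB])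
  rw [← this]
  simp

theorem IsLinearFamily.exists_third (hH : IsLinearFamily H) {B : Finset W} (hB : B ∈ H)
    (hx : x ∈ B) (hy : y ∈ B) (hxy : x ≠ y) :
    ∃ z, z ∈ B ∧ IsBlock H x y z ∧ ∀ v, v ∈ B ↔ v = x ∨ v = y ∨ v = z := by
  classical
  have : ∃ z ∈ B, z ∉ ({x, y} : Finset W) := by
    by_contra! hcon
    have h1 := Finset.card_le_card (show B ⊆ {x, y} from hcon)
    have h2 := Finset.card_le_two (a := x) (b := y)
    have h3 := hH.card_eq B hB
    omega
  obtain ⟨z, hz, hz'⟩ := this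
  simp only [Finset.mem_insert, Finset.mem_singleton, not_or] at hz'
  exact ⟨z, hz, ⟨hxy, Ne.symm hz'.2, Ne.symm hz'.1, B, hB, hx, hy, hz⟩,
    hH.mem_iff hB hxy (Ne.symm hz'.2) (Ne.symm hz'.1) hx hy hz⟩

theorem IsBlock.unique (hH : IsLinearFamily H) (h : IsBlock H x y z) (h' : IsBlock H x y w) :
    z = w := by
  obtain ⟨h1, h2, h3, B, hB, hx, hy, hz⟩ := h
  obtain ⟨h1', h2', h3', B', hB', hx', hy', hz'⟩ := h'
  obtain rfl := hH.eq_of_mem x y h1 B hB B' hB' hx hy hx' hy'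
  rcases (hH.mem_iff hB h1 h2 h3 hx hy hz w).1 hz' with rfl | rfl | rfl
  · exact absurd rfl h3'
  · exact absurd rfl h2'
  · rfl

theorem IsBlock.third_eq (hH : IsLinearFamily H) (h : IsBlock H x y z) : third H x y = z := by
  have h' : BlockAdj H x y := ⟨z, h⟩
  rw [third, dif_pos h']
  exact h'.choose_spec.unique hH h

theorem BlockAdj.isBlock (h : BlockAdj H x y) : IsBlock H x y (third H x y) := by
  rw [third, dif_pos h]
  exact h.choose_spec

theorem BlockAdj.symm (h : BlockAdj H x y) : BlockAdj H y x := let ⟨z, hz⟩ := h; ⟨z, hz.swap⟩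

theorem BlockAdj.ne (h : BlockAdj H x y) : x ≠ y := let ⟨_, hz⟩ := h; hz.1

theorem IsBlock.adj (h : IsBlock H x y z) : BlockAdj H x y := ⟨z, h⟩

end Basic

section Finite

variable {W : Type} [Fintype W] {H : Finset (Finset W)} {x y z w : W}

theorem mem_commonNbrs : w ∈ commonNbrs H x y ↔ BlockAdj H x w ∧ BlockAdj H y w := by
  simp [commonNbrs]

theorem commonNbrs_comm : commonNbrs H x y = commonNbrs H y x := by
  ext w; simp only [mem_commonNbrs, and_comm]

/-- Two points with many common neighbours are joined by a path of two blocks whose other points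
avoid a prescribed finite set. -/
theorem exists_path_avoiding (hH : IsLinearFamily H) (S : Finset W) (hxy : x ≠ y)
    (hS : 3 * S.card < (commonNbrs H x y).card) :
    ∃ w b c, IsBlock H x w b ∧ IsBlock H y w c ∧ w ∉ S ∧ b ∉ S ∧ c ∉ S ∧
      w ≠ b ∧ w ≠ c ∧ b ≠ c := by
  classical
  have hF : (S ∪ S.image (third H x) ∪ S.image (third H y)).card < (commonNbrs H x y).card := by
    refine lt_of_le_of_lt ?_ hS
    have h1 := Finset.card_union_le (S ∪ S.image (third H x)) (S.image (third H y))
    have h2 := Finset.card_union_le S (S.image (third H x))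
    have h3 := Finset.card_image_le (s := S) (f := third H x)
    have h4 := Finset.card_image_le (s := S) (f := third H y)
    omega
  obtain ⟨w, hw, hwF⟩ := Finset.exists_mem_notMem_of_card_lt_card hF
  obtain ⟨⟨b, hb⟩, c, hc⟩ := mem_commonNbrs.1 hw
  simp only [Finset.mem_union, Finset.mem_image, not_or, not_exists, not_and] at hwF
  refine ⟨w, b, c, hb, hc, hwF.1.1, fun h => hwF.1.2 b h (hb.swap_right.third_eq hH),
    fun h => hwF.2 c h (hc.swap_right.third_eq hH), hb.2.1, hc.2.1, ?_⟩
  rintro rfl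
  exact hxy (hb.rot.unique hH hc.rot)

end Finite

/-! ### Triangles with many common neighbours -/

section Density

variable {W : Type} [Fintype W] {H : Finset (Finset W)}

open Classical in
/-- The ordered blocks of `H`. -/
noncomputable def blockTriples (H : Finset (Finset W)) : Finset (W × W × W) :=
  Finset.univ.filter fun x => IsBlock H x.1 x.2.1 x.2.2

theorem mem_blockTriples {x y z : W} : (x, y, z) ∈ blockTriples H ↔ IsBlock H x y z := by
  simp [blockTriples]

theorem explicitDisjoint_of_subset (hH : IsLinearFamily H) {T : Finset (W × W × W)}
    (hT : T ⊆ blockTriples H) : SimpleGraph.TripartiteFromTriangles.ExplicitDisjoint T where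
  inj₀ _ _ _ _ h h' :=
    (mem_blockTriples.1 (hT h)).rot.unique hH (mem_blockTriples.1 (hT h')).rot
  inj₁ _ _ _ _ h h' :=
    (mem_blockTriples.1 (hT h)).swap_right.unique hH (mem_blockTriples.1 (hT h')).swap_right
  inj₂ _ _ _ _ h h' :=
    (mem_blockTriples.1 (hT h)).unique hH (mem_blockTriples.1 (hT h'))

theorem adj_of_mem_crossTriples {T : Finset (W × W × W)} (hT : T ⊆ blockTriples H) {x y z : W}
    (h : (x, y, z) ∈ crossTriples T) : BlockAdj H x y ∧ BlockAdj H y z ∧ BlockAdj H x z := by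
  obtain ⟨⟨c, hc⟩, ⟨b, hb⟩, ⟨a, ha⟩⟩ := mem_crossTriples.1 h
  exact ⟨⟨c, mem_blockTriples.1 (hT hc)⟩, ⟨a, (mem_blockTriples.1 (hT ha)).rot⟩,
    ⟨b, (mem_blockTriples.1 (hT hb)).swap_right⟩⟩

theorem card_blockTriples_le (hH : IsLinearFamily H) :
    (blockTriples H).card ≤ Fintype.card W ^ 2 := by
  classical
  have := card_triples_le (K := 1) (blockTriples H) id (fun x y => {third H x y}) (by simp)
    (fun ⟨x, y, z⟩ h => ⟨x, y, z, by simp [(mem_blockTriples.1 h).third_eq hH], rfl⟩)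
  simpa using this

/-- Every member of `H` gives at least one ordered block. -/
theorem card_le_card_blockTriples (hH : IsLinearFamily H) :
    H.card ≤ (blockTriples H).card := by
  classical
  refine (Finset.card_le_card (t := (blockTriples H).image fun x => {x.1, x.2.1, x.2.2})
    fun B hB => ?_).trans Finset.card_image_le
  obtain ⟨x, y, z, hxy, hxz, hyz, rfl⟩ := Finset.card_eq_three.1 (hH.card_eq B hB)
  exact Finset.mem_image.2
    ⟨(x, y, z), mem_blockTriples.2 ⟨hxy, hyz, hxz, _, hB, by simp, by simp, by simp⟩, rfl⟩

/-- The three pairs of points of a block each have at least `K` common neighbours. -/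
def RichBlock (H : Finset (Finset W)) (K : ℕ) (x y z : W) : Prop :=
  K ≤ (commonNbrs H x y).card ∧ K ≤ (commonNbrs H y z).card ∧ K ≤ (commonNbrs H x z).card

/-- A triangle with corners `x, y, z` and the further points `x', y', z'` of its blocks, each
opposite to the corner of the same name. -/
structure IsTriangle {V : Type*} (H : Finset (Finset V)) (x y z x' y' z' : V) : Prop where
  block_x : IsBlock H y z x'
  block_y : IsBlock H x z y'
  block_z : IsBlock H x y z'
  ne : z ≠ z'

theorem isTriangle_of_mem_crossTriples {T : Finset (W × W × W)} (hT : T ⊆ blockTriples H)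
    {x y z : W} (h : (x, y, z) ∈ crossTriples T) (hn : (x, y, z) ∉ blockTriples H) :
    IsTriangle H x y z (third H y z) (third H x z) (third H x y) := by
  obtain ⟨h1, h2, h3⟩ := adj_of_mem_crossTriples hT h
  refine ⟨h2.isBlock, h3.isBlock, h1.isBlock, fun h => hn (mem_blockTriples.2 ?_)⟩
  have := h1.isBlock
  rwa [← h] at this

theorem exists_mul_sq_lt_mul_cube {c : ℝ} (hc : 0 < c) (K : ℕ) :
    ∃ N : ℕ, 0 < N ∧ ∀ n ≥ N, (K : ℝ) * (n : ℝ) ^ 2 < c * (n : ℝ) ^ 3 := by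
  obtain ⟨N, hN⟩ := exists_nat_gt (K / c)
  refine ⟨N + 1, by omega, fun n hn => ?_⟩
  have h1 : (N : ℝ) + 1 ≤ n := by exact_mod_cast hn
  have h2 : (K : ℝ) < c * n := by
    rw [div_lt_iff₀ hc] at hN
    nlinarith
  have h0 : (0 : ℝ) < n := by
    have : (0 : ℝ) ≤ N := by positivity
    linarith
  have : (0 : ℝ) < (n : ℝ) ^ 2 := by positivity
  calc (K : ℝ) * (n : ℝ) ^ 2 < (c * n) * (n : ℝ) ^ 2 := by gcongr
    _ = c * (n : ℝ) ^ 3 := by ring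

/-- Only few blocks have a pair of points with few common neighbours: each triangle meeting such
a pair is one of few, so a positive proportion of such blocks would contradict triangle removal. -/
theorem exists_card_poor_le {ε : ℝ} (hε : 0 < ε) (K : ℕ) :
    ∃ N : ℕ, ∀ (W : Type) [Fintype W] (H : Finset (Finset W)) (T : Finset (W × W × W)),
      N ≤ Fintype.card W → IsLinearFamily H → T ⊆ blockTriples H →
      (∀ x y z, (x, y, z) ∈ T → (commonNbrs H x y).card ≤ K) →
      (T.card : ℝ) ≤ ε * (Fintype.card W : ℝ) ^ 2 := by
  obtain ⟨c, hc, hcross⟩ := exists_card_crossTriples_ge hε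
  obtain ⟨N, -, hN⟩ := exists_mul_sq_lt_mul_cube hc K
  refine ⟨N, fun W _ H T hW hH hT hpoor => ?_⟩
  classical
  by_contra! hcon
  have h1 := hcross W T (explicitDisjoint_of_subset hH hT) hcon.le
  have h2 : (crossTriples T).card ≤ K * Fintype.card W ^ 2 := by
    refine card_triples_le _ id
      (fun x y => if (commonNbrs H x y).card ≤ K then commonNbrs H x y else ∅) ?_ ?_
    · intro x y
      split_ifs with h
      · exact h
      · simp
    · rintro ⟨x, y, z⟩ h
      refine ⟨x, y, z, ?_, rfl⟩
      obtain ⟨⟨d, hd⟩, -, -⟩ := mem_crossTriples.1 h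
      obtain ⟨-, h2, h3⟩ := adj_of_mem_crossTriples hT h
      rw [if_pos (hpoor x y d hd)]
      exact mem_commonNbrs.2 ⟨h3, h2⟩
  have h3 : ((crossTriples T).card : ℝ) ≤ K * (Fintype.card W : ℝ) ^ 2 := by exact_mod_cast h2
  linarith [hN _ hW]

open Classical in
/-- In a dense linear family at least half of the ordered blocks are rich. -/
theorem exists_card_rich_ge {ε : ℝ} (hε : 0 < ε) (K : ℕ) :
    ∃ N : ℕ, ∀ (W : Type) [Fintype W] (H : Finset (Finset W)),
      N ≤ Fintype.card W → IsLinearFamily H →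
      ε * (Fintype.card W : ℝ) ^ 2 ≤ (blockTriples H).card →
      ε / 2 * (Fintype.card W : ℝ) ^ 2 ≤
        ((blockTriples H).filter fun x => RichBlock H K x.1 x.2.1 x.2.2).card := by
  obtain ⟨N, hN⟩ := exists_card_poor_le (ε := ε / 6) (by positivity) K
  refine ⟨N, fun W _ H hW hH hd => ?_⟩
  set T := (blockTriples H).filter fun x => RichBlock H K x.1 x.2.1 x.2.2
  set P := (blockTriples H).filter fun x => (commonNbrs H x.1 x.2.1).card ≤ K
  have hP : (P.card : ℝ) ≤ ε / 6 * (Fintype.card W : ℝ) ^ 2 :=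
    hN W H P hW hH (Finset.filter_subset _ _) fun x y z h => (Finset.mem_filter.1 h).2
  have hsub : blockTriples H ⊆ T ∪ (P ∪ (P.image (fun x => (x.2.2, x.1, x.2.1)) ∪
      P.image fun x => (x.1, x.2.2, x.2.1))) := by
    rintro ⟨x, y, z⟩ h
    have hb := mem_blockTriples.1 h
    by_cases h1 : K ≤ (commonNbrs H x y).card
    · by_cases h2 : K ≤ (commonNbrs H y z).card
      · by_cases h3 : K ≤ (commonNbrs H x z).card
        · exact Finset.mem_union_left _ (Finset.mem_filter.2 ⟨h, h1, h2, h3⟩)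
        · refine Finset.mem_union_right _ (Finset.mem_union_right _ (Finset.mem_union_right _
            (Finset.mem_image.2 ⟨(x, z, y), Finset.mem_filter.2 ⟨?_, ?_⟩, rfl⟩)))
          · exact mem_blockTriples.2 hb.swap_right
          · exact (not_le.1 h3).le
      · refine Finset.mem_union_right _ (Finset.mem_union_right _ (Finset.mem_union_left _
          (Finset.mem_image.2 ⟨(y, z, x), Finset.mem_filter.2 ⟨?_, ?_⟩, rfl⟩)))
        · exact mem_blockTriples.2 hb.rot
        · exact (not_le.1 h2).le
    · exact Finset.mem_union_right _ (Finset.mem_union_left _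
        (Finset.mem_filter.2 ⟨h, (not_le.1 h1).le⟩))
  have hle : (blockTriples H).card ≤ T.card + 3 * P.card := by
    refine (Finset.card_le_card hsub).trans ?_
    refine (Finset.card_union_le _ _).trans (Nat.add_le_add_left ?_ _)
    refine (Finset.card_union_le _ _).trans ?_
    have h1 := Finset.card_union_le (P.image (fun x => (x.2.2, x.1, x.2.1)))
      (P.image fun x => (x.1, x.2.2, x.2.1))
    have h2 := Finset.card_image_le (s := P) (f := fun x : W × W × W => (x.2.2, x.1, x.2.1))
    have h3 := Finset.card_image_le (s := P) (f := fun x : W × W × W => (x.1, x.2.2, x.2.1))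
    omega
  have hle' : ((blockTriples H).card : ℝ) ≤ T.card + 3 * P.card := by exact_mod_cast hle
  linarith

/-- A dense linear family contains a triangle all of whose blocks are rich. -/
theorem exists_rich_triangle {ε : ℝ} (hε : 0 < ε) (K : ℕ) :
    ∃ N : ℕ, ∀ (W : Type) [Fintype W] (H : Finset (Finset W)),
      N ≤ Fintype.card W → IsLinearFamily H →
      ε * (Fintype.card W : ℝ) ^ 2 ≤ (blockTriples H).card →
      ∃ x y z x' y' z', IsTriangle H x y z x' y' z' ∧
        RichBlock H K y z x' ∧ RichBlock H K x z y' ∧ RichBlock H K x y z' := by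
  obtain ⟨N₁, hN₁⟩ := exists_card_rich_ge hε K
  obtain ⟨c, hc, hcross⟩ := exists_card_crossTriples_ge (half_pos hε)
  obtain ⟨N₂, -, hN₂⟩ := exists_mul_sq_lt_mul_cube hc 1
  refine ⟨max N₁ N₂, fun W _ H hW hH hd => ?_⟩
  classical
  have hT := hN₁ W H ((le_max_left _ _).trans hW) hH hd
  set T := (blockTriples H).filter fun x => RichBlock H K x.1 x.2.1 x.2.2 with hTdef
  have hTs : T ⊆ blockTriples H := Finset.filter_subset _ _
  have h1 := hcross W T (explicitDisjoint_of_subset hH hTs) hT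
  have h2 := hN₂ _ ((le_max_right _ _).trans hW)
  have h3 : ((blockTriples H).card : ℝ) ≤ (Fintype.card W : ℝ) ^ 2 := by
    exact_mod_cast card_blockTriples_le hH
  have h4 : (blockTriples H).card < (crossTriples T).card := by
    have : ((blockTriples H).card : ℝ) < (crossTriples T).card := by push_cast at h2; linarith
    exact_mod_cast this
  obtain ⟨⟨x, y, z⟩, hx, hxn⟩ := Finset.exists_mem_notMem_of_card_lt_card h4
  refine ⟨x, y, z, _, _, _, isTriangle_of_mem_crossTriples hTs hx hxn, ?_⟩
  obtain ⟨⟨c, hc⟩, ⟨b, hb⟩, ⟨a, ha⟩⟩ := mem_crossTriples.1 hx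
  have ka := mem_blockTriples.1 (hTs ha)
  have kb := mem_blockTriples.1 (hTs hb)
  have kc := mem_blockTriples.1 (hTs hc)
  have ra : RichBlock H K a y z := (Finset.mem_filter.1 ha).2
  have rb : RichBlock H K x b z := (Finset.mem_filter.1 hb).2
  have rc : RichBlock H K x y c := (Finset.mem_filter.1 hc).2
  rw [ka.rot.third_eq hH, kb.swap_right.third_eq hH, kc.third_eq hH]
  refine ⟨⟨ra.2.1, ?_, ?_⟩, ⟨rb.2.2, ?_, rb.1⟩, rc⟩
  · rw [commonNbrs_comm]; exact ra.2.2
  · rw [commonNbrs_comm]; exact ra.1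
  · rw [commonNbrs_comm]; exact rb.2.1

/-- A dense linear family contains a triangle with a corner that has many common neighbours with
the opposite point. -/
theorem exists_triangle_corner_opposite {ε : ℝ} (hε : 0 < ε) (K : ℕ) :
    ∃ N : ℕ, ∀ (W : Type) [Fintype W] (H : Finset (Finset W)),
      N ≤ Fintype.card W → IsLinearFamily H →
      ε * (Fintype.card W : ℝ) ^ 2 ≤ (blockTriples H).card →
      ∃ x y z x' y' z', IsTriangle H x y z x' y' z' ∧ K ≤ (commonNbrs H z z').card := by
  obtain ⟨c, hc, hcross⟩ := exists_card_crossTriples_ge hε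
  obtain ⟨N, -, hN⟩ := exists_mul_sq_lt_mul_cube hc (1 + K)
  refine ⟨N, fun W _ H hW hH hd => ?_⟩
  classical
  have h1 := hcross W _ (explicitDisjoint_of_subset hH subset_rfl) hd
  have h2 := hN _ hW
  have h3 := card_blockTriples_le hH
  set P := (crossTriples (blockTriples H)).filter
    fun x => (commonNbrs H x.2.2 (third H x.1 x.2.1)).card ≤ K with hP
  -- A cross triple is determined by the points `z, z'` and a common neighbour `x` of theirs.
  have h4 : P.card ≤ K * Fintype.card W ^ 2 := by
    refine card_triples_le _ (fun x => (x.2.2, third H x.2.1 x.2.2, x.1))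
      (fun z z' => if (commonNbrs H z z').card ≤ K then commonNbrs H z z' else ∅) ?_ ?_
    · intro x y
      split_ifs with h
      · exact h
      · simp
    · rintro ⟨x, y, z⟩ h
      obtain ⟨hx, hk⟩ := Finset.mem_filter.1 h
      obtain ⟨k1, k2, k3⟩ := adj_of_mem_crossTriples subset_rfl hx
      have k4 := k1.isBlock
      refine ⟨z, third H x y, x, ?_, ?_⟩
      · rw [if_pos hk]
        exact mem_commonNbrs.2 ⟨k3.symm, k4.rot.rot.adj⟩
      · dsimp only
        rw [k4.rot.rot.third_eq hH]
  have h5 : (blockTriples H ∪ P).card < (crossTriples (blockTriples H)).card := by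
    have k1 : (blockTriples H ∪ P).card ≤ (1 + K) * Fintype.card W ^ 2 :=
      (Finset.card_union_le _ _).trans (by nlinarith)
    have k2 : ((blockTriples H ∪ P).card : ℝ) ≤ ((1 + K : ℕ) : ℝ) * (Fintype.card W : ℝ) ^ 2 := by
      exact_mod_cast k1
    have : ((blockTriples H ∪ P).card : ℝ) < (crossTriples (blockTriples H)).card := by linarith
    exact_mod_cast this
  obtain ⟨⟨x, y, z⟩, hx, hxn⟩ := Finset.exists_mem_notMem_of_card_lt_card h5
  rw [Finset.mem_union, not_or] at hxn
  refine ⟨x, y, z, _, _, _, isTriangle_of_mem_crossTriples subset_rfl hx hxn.1, ?_⟩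
  by_contra! hk
  exact hxn.2 (Finset.mem_filter.2 ⟨hx, hk.le⟩)

end Density

/-! ### Averaging over a point -/

section Averaging

variable {W : Type} [Fintype W] {H : Finset (Finset W)}

/-- If a family of sets indexed by the points receives an injection from the cross triples of the
blocks, then these sets have large total size. -/
theorem card_le_sum_card_of_injOn {T : Finset (W × W × W)} (F : W → Finset (W × W × W))
    (g : W × W × W → W) (k : W × W × W → W × W × W)
    (hmem : ∀ x ∈ T, k x ∈ F (g x))
    (hinj : ∀ x ∈ T, ∀ y ∈ T, g x = g y → k x = k y → x = y) :
    T.card ≤ ∑ w, (F w).card := by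
  classical
  rw [← Finset.card_sigma]
  refine Finset.card_le_card_of_injOn (fun x => ⟨g x, k x⟩) ?_ ?_
  · intro x hx
    exact Finset.mem_sigma.2 ⟨Finset.mem_univ _, hmem x hx⟩
  · intro x hx y hy hxy
    simp only [Sigma.mk.injEq, heq_eq_eq] at hxy
    exact hinj x hx y hy hxy.1 hxy.2

open Classical in
/-- The ordered blocks whose last two points are adjacent to `w`. -/
noncomputable def linkTriples (H : Finset (Finset W)) (w : W) : Finset (W × W × W) :=
  (blockTriples H).filter fun x => BlockAdj H w x.2.1 ∧ BlockAdj H w x.2.2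

theorem card_crossTriples_le_sum_linkTriples :
    (crossTriples (blockTriples H)).card ≤ ∑ w, (linkTriples H w).card := by
  classical
  refine card_le_sum_card_of_injOn _ (fun x => x.2.2)
    (fun x => (third H x.1 x.2.1, x.1, x.2.1)) ?_ ?_
  · rintro ⟨x, y, z⟩ h
    obtain ⟨h1, h2, h3⟩ := adj_of_mem_crossTriples subset_rfl h
    exact Finset.mem_filter.2 ⟨mem_blockTriples.2 h1.isBlock.rot.rot, h3.symm, h2.symm⟩
  · rintro ⟨x, y, z⟩ - ⟨x₁, y₁, z₁⟩ - h h'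
    simp only [Prod.mk.injEq] at h h' ⊢
    exact ⟨h'.2.1, h'.2.2, h⟩

/-- A dense linear family contains a triangle two of whose non-corner points have many common
neighbours. For a positive proportion of the points `w`, triangle removal in the blocks with two
points adjacent to `w` gives a positive proportion of triangles for which `w` is a common
neighbour of the two points in question; hence some triangle arises from many `w`. -/
theorem exists_triangle_sides {ε : ℝ} (hε : 0 < ε) (K : ℕ) :
    ∃ N : ℕ, ∀ (W : Type) [Fintype W] (H : Finset (Finset W)),
      N ≤ Fintype.card W → IsLinearFamily H →
      ε * (Fintype.card W : ℝ) ^ 2 ≤ (blockTriples H).card →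
      ∃ x y z x' y' z', IsTriangle H x y z x' y' z' ∧ K ≤ (commonNbrs H y' z').card := by
  obtain ⟨c, hc, hcross⟩ := exists_card_crossTriples_ge hε
  obtain ⟨d, hd, hcross'⟩ := exists_card_crossTriples_ge (half_pos hc)
  obtain ⟨N, hN0, hN⟩ := exists_mul_sq_lt_mul_cube (c := c / 2 * d) (by positivity) (1 + K)
  refine ⟨N, fun W _ H hW hH hden => ?_⟩
  classical
  have h1 := hcross W _ (explicitDisjoint_of_subset hH subset_rfl) hden
  by_contra! hcon
  set n : ℕ := Fintype.card W with hn
  have hn0 : (0 : ℝ) < n := by exact_mod_cast lt_of_lt_of_le hN0 hW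
  set G : Finset W :=
    Finset.univ.filter fun w => c / 2 * (n : ℝ) ^ 2 ≤ (linkTriples H w).card with hG
  have hsub : ∀ w, linkTriples H w ⊆ blockTriples H := fun w => Finset.filter_subset _ _
  -- many points `w` have a dense set of link triples
  have hGcard : c / 2 * n ≤ G.card := by
    have h2 : ((crossTriples (blockTriples H)).card : ℝ) ≤ ∑ w, ((linkTriples H w).card : ℝ) := by
      exact_mod_cast card_crossTriples_le_sum_linkTriples (H := H)
    have h3 : ∑ w, ((linkTriples H w).card : ℝ) ≤
        ∑ w, ((if w ∈ G then (n : ℝ) ^ 2 else 0) + c / 2 * (n : ℝ) ^ 2) := by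
      refine Finset.sum_le_sum fun w _ => ?_
      have hle : ((linkTriples H w).card : ℝ) ≤ (n : ℝ) ^ 2 := by
        exact_mod_cast (Finset.card_le_card (hsub w)).trans (card_blockTriples_le hH)
      split_ifs with hw
      · have : 0 ≤ c / 2 * (n : ℝ) ^ 2 := by positivity
        linarith
      · have : ¬ c / 2 * (n : ℝ) ^ 2 ≤ (linkTriples H w).card := fun h =>
          hw (Finset.mem_filter.2 ⟨Finset.mem_univ _, h⟩)
        linarith
    have h4 : ∑ w : W, ((if w ∈ G then (n : ℝ) ^ 2 else 0) + c / 2 * (n : ℝ) ^ 2) =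
        G.card * (n : ℝ) ^ 2 + n * (c / 2 * (n : ℝ) ^ 2) := by
      rw [Finset.sum_add_distrib, Finset.sum_ite_mem, Finset.univ_inter, Finset.sum_const,
        Finset.sum_const, nsmul_eq_mul, nsmul_eq_mul, Finset.card_univ]
    have h5 : c / 2 * n * (n : ℝ) ^ 2 ≤ G.card * (n : ℝ) ^ 2 := by nlinarith
    exact le_of_mul_le_mul_right h5 (by positivity)
  -- count the pairs of a point `w` in `G` and a cross triple of its link triples
  have hlow : c / 2 * n * (d * (n : ℝ) ^ 3) ≤
      ∑ w ∈ G, ((crossTriples (linkTriples H w)).card : ℝ) := by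
    calc c / 2 * n * (d * (n : ℝ) ^ 3) ≤ G.card * (d * (n : ℝ) ^ 3) := by gcongr
      _ = ∑ w ∈ G, d * (n : ℝ) ^ 3 := by rw [Finset.sum_const, nsmul_eq_mul]
      _ ≤ _ := Finset.sum_le_sum fun w hw => hcross' W _
        (explicitDisjoint_of_subset hH (hsub w)) (Finset.mem_filter.1 hw).2
  have hswap : ∑ w ∈ G, (crossTriples (linkTriples H w)).card =
      ∑ x : W × W × W, (G.filter fun w => x ∈ crossTriples (linkTriples H w)).card := by
    have := Finset.sum_card_bipartiteAbove_eq_sum_card_bipartiteBelow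
      (s := G) (t := (Finset.univ : Finset (W × W × W)))
      (fun w x => x ∈ crossTriples (linkTriples H w))
    simpa [Finset.bipartiteAbove, Finset.bipartiteBelow] using this
  have hterm : ∀ x : W × W × W, (G.filter fun w => x ∈ crossTriples (linkTriples H w)).card ≤
      (if x ∈ blockTriples H then n else 0) + K := by
    rintro ⟨x, y, z⟩
    split_ifs with hb
    · exact (Finset.card_le_univ _).trans (Nat.le_add_right _ _)
    · rw [zero_add]
      rcases Finset.eq_empty_or_nonempty
        (G.filter fun w => (x, y, z) ∈ crossTriples (linkTriples H w)) with he | ⟨w₀, hw₀⟩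
      · rw [he]; simp
      · have ht := isTriangle_of_mem_crossTriples (hsub w₀) (Finset.mem_filter.1 hw₀).2 hb
        refine (Finset.card_le_card fun w hw => ?_).trans (hcon _ _ _ _ _ _ ht).le
        obtain ⟨⟨p, hp⟩, ⟨q, hq⟩, -⟩ := mem_crossTriples.1 (Finset.mem_filter.1 hw).2
        obtain ⟨hp1, -, hp2⟩ := Finset.mem_filter.1 hp
        obtain ⟨hq1, hq2, -⟩ := Finset.mem_filter.1 hq
        rw [(mem_blockTriples.1 hp1).third_eq hH, (mem_blockTriples.1 hq1).swap_right.third_eq hH]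
        exact mem_commonNbrs.2 ⟨hq2.symm, hp2.symm⟩
  have hup : ∑ w ∈ G, (crossTriples (linkTriples H w)).card ≤ (1 + K) * n ^ 3 := by
    rw [hswap]
    refine (Finset.sum_le_sum fun x _ => hterm x).trans ?_
    rw [Finset.sum_add_distrib, Finset.sum_ite_mem, Finset.univ_inter, Finset.sum_const,
      Finset.sum_const, smul_eq_mul, smul_eq_mul, Finset.card_univ, Fintype.card_prod,
      Fintype.card_prod]
    have := card_blockTriples_le hH
    nlinarith
  have hup' : ∑ w ∈ G, ((crossTriples (linkTriples H w)).card : ℝ) ≤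
      ((1 + K : ℕ) : ℝ) * (n : ℝ) ^ 3 := by exact_mod_cast hup
  have hfin := mul_lt_mul_of_pos_right (hN n hW) hn0
  nlinarith

open Classical in
/-- The triples `(x, z, y)` for which `x, y, z` is a block, `y` is adjacent to `g`, and the third
point of the block through `g` and `y` is adjacent to `z`. -/
noncomputable def rungTriples (H : Finset (Finset W)) (g : W) : Finset (W × W × W) :=
  (blockTriples H).filter fun x => BlockAdj H g x.2.2 ∧ BlockAdj H (third H g x.2.2) x.2.1

theorem card_crossTriples_le_sum_rungTriples (hH : IsLinearFamily H) :
    (crossTriples (blockTriples H)).card ≤ ∑ g, (rungTriples H g).card := by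
  classical
  refine card_le_sum_card_of_injOn _ (fun x => third H x.1 x.2.2)
    (fun x => (third H x.1 x.2.1, x.2.1, x.1)) ?_ ?_
  · rintro ⟨y, z, x'⟩ h
    obtain ⟨h1, h2, h3⟩ := adj_of_mem_crossTriples subset_rfl h
    refine Finset.mem_filter.2 ⟨mem_blockTriples.2 h1.isBlock.rot.rot.swap_right, ?_, ?_⟩
    · exact h3.isBlock.rot.rot.adj
    · dsimp only
      rw [h3.isBlock.rot.rot.third_eq hH]
      exact h2.symm
  · rintro ⟨y, z, x'⟩ h ⟨y₁, z₁, x₁'⟩ h₁ e e'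
    simp only [Prod.mk.injEq] at e e' ⊢
    obtain ⟨-, -, h3⟩ := adj_of_mem_crossTriples subset_rfl h
    obtain ⟨-, -, k3⟩ := adj_of_mem_crossTriples subset_rfl h₁
    obtain ⟨-, rfl, rfl⟩ := e'
    refine ⟨rfl, rfl, ?_⟩
    have k4 := k3.isBlock
    rw [← e] at k4
    exact h3.isBlock.swap_right.unique hH k4.swap_right

end Averaging

/-! ### Two disjoint blocks joined by three blocks -/

section Nondegenerate

theorem IsTriangle.nodup {V : Type*} {H : Finset (Finset V)} (hH : IsLinearFamily H)
    {x y z x' y' z' : V} (h : IsTriangle H x y z x' y' z') :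
    [x, y, z, x', y', z'].Nodup := by
  obtain ⟨hx, hy, hz, hne⟩ := h
  have u : ∀ a b c d, IsBlock H a b c → IsBlock H a b d → c = d :=
    fun a b c d h h' => h.unique hH h'
  have s : ∀ a b c, IsBlock H a b c → IsBlock H b a c := fun a b c h => h.swap
  have r : ∀ a b c, IsBlock H a b c → IsBlock H a c b := fun a b c h => h.swap_right
  have n : ∀ a b c, IsBlock H a b c → a ≠ b := fun a b c h => h.1
  simp only [List.nodup_cons, List.mem_cons, List.not_mem_nil, not_or, not_false_eq_true,
    List.nodup_nil, and_true, or_false]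
  refine ⟨⟨?_, ?_, ?_, ?_, ?_⟩, ⟨?_, ?_, ?_, ?_⟩, ⟨?_, ?_, ?_⟩, ⟨?_, ?_⟩, ?_⟩ <;> grind

/-- The nine points of two disjoint blocks joined by three blocks, as found from a cross triple of
the rung triples, are distinct once eight coincidences are excluded, each of which determines one
entry of the cross triple from the other two. -/
theorem ladder_nodup {W : Type*} {H : Finset (Finset W)} (hH : IsLinearFamily H)
    {x y z x' y' g p q r : W}
    (h₁ : IsBlock H x y z) (h₂ : IsBlock H x' y' g) (h₃ : IsBlock H x y' p)
    (h₄ : IsBlock H y g q) (h₅ : IsBlock H z x' r) (hzy : BlockAdj H z y')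
    (e₁ : z ≠ g) (e₂ : y ≠ x') (e₃ : y ≠ y') (e₄ : p ≠ q) (e₅ : p ≠ r) (e₆ : q ≠ r)
    (e₇ : x ≠ g) (e₈ : x ≠ x') :
    [x, y, z, x', y', g, p, q, r].Nodup := by
  have hzy' := hzy.ne
  have u : ∀ a b c d, IsBlock H a b c → IsBlock H a b d → c = d :=
    fun a b c d h h' => h.unique hH h'
  have s : ∀ a b c, IsBlock H a b c → IsBlock H b a c := fun a b c h => h.swap
  have r : ∀ a b c, IsBlock H a b c → IsBlock H a c b := fun a b c h => h.swap_right
  have n : ∀ a b c, IsBlock H a b c → a ≠ b := fun a b c h => h.1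
  simp only [List.nodup_cons, List.mem_cons, List.not_mem_nil, not_or, not_false_eq_true,
    List.nodup_nil, and_true, or_false]
  refine ⟨⟨?_, ?_, ?_, ?_, ?_, ?_, ?_, ?_⟩, ⟨?_, ?_, ?_, ?_, ?_, ?_, ?_⟩,
    ⟨?_, ?_, ?_, ?_, ?_, ?_⟩, ⟨?_, ?_, ?_, ?_, ?_⟩, ⟨?_, ?_, ?_, ?_⟩, ⟨?_, ?_, ?_⟩,
    ⟨?_, ?_⟩, ?_⟩ <;> grind

/-- A dense linear family contains two disjoint blocks `x, y, z` and `x', y', g` joined by three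
blocks with further points `p, q, r`. -/
theorem exists_ladder {ε : ℝ} (hε : 0 < ε) :
    ∃ N : ℕ, ∀ (W : Type) [Fintype W] (H : Finset (Finset W)),
      N ≤ Fintype.card W → IsLinearFamily H →
      ε * (Fintype.card W : ℝ) ^ 2 ≤ (blockTriples H).card →
      ∃ x y z x' y' g p q r, IsBlock H x y z ∧ IsBlock H x' y' g ∧ IsBlock H x y' p ∧
        IsBlock H y g q ∧ IsBlock H z x' r ∧ [x, y, z, x', y', g, p, q, r].Nodup := by
  obtain ⟨c, hc, hcross⟩ := exists_card_crossTriples_ge hε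
  obtain ⟨d, hd, hcross'⟩ := exists_card_crossTriples_ge hc
  obtain ⟨N, hN0, hN⟩ := exists_mul_sq_lt_mul_cube hd 8
  refine ⟨N, fun W _ H hW hH hden => ?_⟩
  classical
  have h1 := hcross W _ (explicitDisjoint_of_subset hH subset_rfl) hden
  have hsub : ∀ g, rungTriples H g ⊆ blockTriples H := fun g => Finset.filter_subset _ _
  obtain ⟨g, hg⟩ : ∃ g, c * (Fintype.card W : ℝ) ^ 2 ≤ (rungTriples H g).card := by
    by_contra! hcon
    have : Nonempty W := Fintype.card_pos_iff.1 (lt_of_lt_of_le hN0 hW)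
    have h2 : ((crossTriples (blockTriples H)).card : ℝ) ≤ ∑ w, ((rungTriples H w).card : ℝ) := by
      exact_mod_cast card_crossTriples_le_sum_rungTriples hH
    have h3 := Finset.sum_lt_sum_of_nonempty (Finset.univ_nonempty (α := W)) fun w _ => hcon w
    rw [Finset.sum_const, nsmul_eq_mul, Finset.card_univ] at h3
    nlinarith
  have h2 := hcross' W _ (explicitDisjoint_of_subset hH (hsub g)) hg
  have h3 := hN _ hW
  -- the cross triples that satisfy one of the eight coincidences
  let t := third H
  let F₁ : W → W → Finset W := fun x y' =>
    {g, t x (t g y'), t x y', t x (t g (t x y')), t (t g y') (t x y')}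
  let F₂ : W → W → Finset W := fun x z => {t g (t z (t (t x z) g))}
  let F₃ : W → W → Finset W := fun _ y' => {g, t g y'}
  set P := crossTriples (rungTriples H g) with hP
  have k1 : (P.filter fun x => x.2.1 ∈ F₁ x.1 x.2.2).card ≤ 5 * Fintype.card W ^ 2 := by
    refine card_triples_le _ (fun x => (x.1, x.2.2, x.2.1)) F₁ (fun x y' => Finset.card_le_five) ?_
    rintro ⟨x, z, y'⟩ h
    exact ⟨x, y', z, (Finset.mem_filter.1 h).2, rfl⟩
  have k2 : (P.filter fun x => x.2.2 ∈ F₂ x.1 x.2.1).card ≤ 1 * Fintype.card W ^ 2 := by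
    refine card_triples_le _ id F₂ (fun x y' => (Finset.card_singleton _).le) ?_
    rintro ⟨x, z, y'⟩ h
    exact ⟨x, z, y', (Finset.mem_filter.1 h).2, rfl⟩
  have k3 : (P.filter fun x => x.1 ∈ F₃ x.2.1 x.2.2).card ≤ 2 * Fintype.card W ^ 2 := by
    refine card_triples_le _ (fun x => (x.2.2, x.1, x.2.1)) F₃ (fun x y' => Finset.card_le_two) ?_
    rintro ⟨x, z, y'⟩ h
    exact ⟨z, y', x, (Finset.mem_filter.1 h).2, rfl⟩
  have h4 : ((P.filter fun x => x.2.1 ∈ F₁ x.1 x.2.2) ∪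
      ((P.filter fun x => x.2.2 ∈ F₂ x.1 x.2.1) ∪ P.filter fun x => x.1 ∈ F₃ x.2.1 x.2.2)).card <
      P.card := by
    have k4 := (Finset.card_union_le (P.filter fun x => x.2.1 ∈ F₁ x.1 x.2.2)
      ((P.filter fun x => x.2.2 ∈ F₂ x.1 x.2.1) ∪ P.filter fun x => x.1 ∈ F₃ x.2.1 x.2.2)).trans
      (Nat.add_le_add_left (Finset.card_union_le _ _) _)
    have k5 : 8 * Fintype.card W ^ 2 < P.card := by
      have : ((8 : ℕ) : ℝ) * (Fintype.card W : ℝ) ^ 2 < P.card := by linarith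
      exact_mod_cast this
    omega
  obtain ⟨⟨x, z, y'⟩, hx, hxn⟩ := Finset.exists_mem_notMem_of_card_lt_card h4
  simp only [Finset.mem_union, Finset.mem_filter, hx, true_and, not_or] at hxn
  obtain ⟨hF₁, hF₂, hF₃⟩ := hxn
  obtain ⟨⟨y, hy⟩, ⟨b, hb⟩, ⟨a, ha⟩⟩ := mem_crossTriples.1 hx
  obtain ⟨hy1, hy2, -⟩ := Finset.mem_filter.1 hy
  obtain ⟨hb1, hb2, -⟩ := Finset.mem_filter.1 hb
  obtain ⟨ha1, -, ha3⟩ := Finset.mem_filter.1 ha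
  rw [mem_blockTriples] at hy1 hb1 ha1
  dsimp only at hy2 hb2 ha3
  have g₁ : IsBlock H x y z := hy1.swap_right
  have g₂ : IsBlock H (t g y') y' g := hb2.isBlock.rot.rot.swap_right
  have g₃ : IsBlock H x y' (t x y') := hb1.swap_right.adj.isBlock
  have g₄ : IsBlock H y g (t y g) := hy2.symm.isBlock
  have g₅ : IsBlock H z (t g y') (t z (t g y')) := ha3.symm.isBlock
  refine ⟨x, y, z, t g y', y', g, t x y', t y g, t z (t g y'), g₁, g₂, g₃, g₄, g₅,
    ladder_nodup hH g₁ g₂ g₃ g₄ g₅ ha1.rot.adj ?_ ?_ ?_ ?_ ?_ ?_ ?_ ?_⟩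
  · rintro rfl; simp [F₁] at hF₁
  · rintro h
    exact hF₁ (by simp [F₁, ← h, t, g₁.third_eq hH])
  · rintro rfl
    exact hF₁ (by simp [F₁, t, g₁.third_eq hH])
  · intro h
    refine hF₁ ?_
    have e : t g (t x y') = y := by rw [h]; exact g₄.rot.third_eq hH
    simp only [F₁, Finset.mem_insert]
    right; right; right; left
    rw [e]; exact (g₁.third_eq hH).symm
  · intro h
    refine hF₁ ?_
    simp only [F₁, Finset.mem_insert, Finset.mem_singleton]
    right; right; right; right
    rw [h]; exact (g₅.rot.third_eq hH).symm
  · intro h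
    refine hF₂ ?_
    simp only [F₂, Finset.mem_singleton]
    have e : t x z = y := hy1.third_eq hH
    have e' : t z (t y g) = t g y' := by rw [h]; exact g₅.swap_right.third_eq hH
    rw [e, e']
    exact (g₂.rot.rot.third_eq hH).symm
  · rintro rfl; simp [F₃] at hF₃
  · intro h
    exact hF₃ (by simp [F₃, ← h])

end Nondegenerate

/-! ### Embeddings and reattaching a block -/

/-- The family `𝓑` embeds into the family `H`: some map, injective on the points covered by `𝓑`,
sends each member of `𝓑` into a member of `H`. -/
def FamilyEmbeds {V W : Type*} (𝓑 : Finset (Finset V)) (H : Finset (Finset W)) : Prop :=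
  ∃ f : V → W, Set.InjOn f {v | ∃ B ∈ 𝓑, v ∈ B} ∧ ∀ B ∈ 𝓑, ∃ B' ∈ H, ∀ v ∈ B, f v ∈ B'

open Classical in
/-- The family `𝓑` embeds into every sufficiently large dense linear family of triples in which
all points that are covered at all have large degree. -/
def IsDenseUnavoidable {V : Type*} (𝓑 : Finset (Finset V)) : Prop :=
  ∀ ε : ℝ, 0 < ε → ∃ N : ℕ, ∀ (W : Type) [Fintype W] (H : Finset (Finset W)),
    N ≤ Fintype.card W → IsLinearFamily H →
    (∀ v, (∃ B ∈ H, v ∈ B) → N ≤ (H.filter fun B => v ∈ B).card) →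
    ε * (Fintype.card W : ℝ) ^ 2 ≤ H.card → FamilyEmbeds 𝓑 H

/-- All points of `X` are among `a, b, c`. -/
def LiesIn {V : Type*} (X : Finset V) (a b c : V) : Prop := ∀ v ∈ X, v = a ∨ v = b ∨ v = c

section Embedding

variable {V W : Type*} {𝓑 : Finset (Finset V)} {H : Finset (Finset W)}

/-- A labelling of points of `H` by the points of `𝓑` gives an embedding. -/
theorem familyEmbeds_of_labelling {ι : Type*} [Nonempty ι] (p : ι → V) (hp : Function.Injective p)
    (h : ι → W) (hh : Function.Injective h)
    (hB : ∀ X ∈ 𝓑, ∃ i j k, LiesIn X (p i) (p j) (p k) ∧ IsBlock H (h i) (h j) (h k)) :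
    FamilyEmbeds 𝓑 H := by
  obtain ⟨i₀⟩ := ‹Nonempty ι›
  refine ⟨Function.extend p h fun _ => h i₀, ?_, ?_⟩
  · have key : ∀ v, (∃ X ∈ 𝓑, v ∈ X) → ∃ i, p i = v := by
      rintro v ⟨X, hX, hv⟩
      obtain ⟨i, j, k, hl, -⟩ := hB X hX
      rcases hl v hv with h | h | h
      exacts [⟨i, h.symm⟩, ⟨j, h.symm⟩, ⟨k, h.symm⟩]
    rintro v hv w hw hvw
    obtain ⟨i, rfl⟩ := key v hv
    obtain ⟨j, rfl⟩ := key w hw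
    rw [hp.extend_apply, hp.extend_apply] at hvw
    rw [hh hvw]
  · intro X hX
    obtain ⟨i, j, k, hl, -, -, -, B', hB', hi, hj, hk⟩ := hB X hX
    refine ⟨B', hB', fun v hv => ?_⟩
    rcases hl v hv with rfl | rfl | rfl <;> rwa [hp.extend_apply]

open Classical in
/-- A triple that meets the other members of a family in at most one point can be reattached: the
degree condition provides many triples at that point, the density condition many triples
elsewhere. -/
theorem IsDenseUnavoidable.of_erase {B : Finset V} (hB : B ∈ 𝓑) (hcard : B.card = 3) (p : V)
    (hp : ∀ B' ∈ 𝓑, B' ≠ B → ∀ q ∈ B, q ∈ B' → q = p)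
    (h : IsDenseUnavoidable (𝓑.erase B)) : IsDenseUnavoidable 𝓑 := by
  intro ε hε
  obtain ⟨N₀, hN₀⟩ := h ε hε
  set s : Finset V := (𝓑.erase B).biUnion id with hs
  obtain ⟨N₁, hN₁0, hN₁⟩ := exists_mul_sq_lt_mul_cube hε s.card
  refine ⟨max (max N₀ N₁) (s.card + 1), fun W _ H hW hH hdeg hd => ?_⟩
  have hW0 : N₀ ≤ Fintype.card W := by omega
  have hW1 : N₁ ≤ Fintype.card W := by omega
  obtain ⟨f, hf, hfB⟩ := hN₀ W H hW0 hH (fun v hv => le_trans (by omega) (hdeg v hv)) hd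
  have hs' : ∀ v, v ∈ s ↔ ∃ X ∈ 𝓑.erase B, v ∈ X := by simp [hs]
  -- it suffices to find a triple that meets the image of the other points only where it must
  have : Nonempty V := ⟨p⟩
  have : Nonempty W := Fintype.card_pos_iff.1 (lt_of_lt_of_le hN₁0 hW1)
  suffices hsuff : ∃ B' ∈ H, ∃ q ∈ B', (p ∈ B → p ∈ s → q = f p) ∧
      ∀ v ∈ s, f v ∈ B' → p ∈ B ∧ v = p by
    obtain ⟨B', hB', q, hq, hqp, hav⟩ := hsuff
    -- a bijection from `B` to `B'` sending `p` to `q` if `p` lies on `B`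
    obtain ⟨e, he, hep⟩ : ∃ e : V → W, (Set.InjOn e B ∧ ∀ v ∈ B, e v ∈ B') ∧
        (p ∈ B → e p = q) := by
      have h1 : B.card = B'.card := by rw [hcard, hH.card_eq B' hB']
      obtain ⟨e₀⟩ : Nonempty (B ≃ B') := ⟨Finset.equivOfCardEq h1⟩
      have he₀ : ∀ e₁ : B ≃ B', Set.InjOn (fun v => if h : v ∈ B then (e₁ ⟨v, h⟩ : W) else q) B ∧
          ∀ v ∈ B, (if h : v ∈ B then (e₁ ⟨v, h⟩ : W) else q) ∈ B' := by
        intro e₁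
        refine ⟨fun v hv w hw hvw => ?_, fun v hv => ?_⟩
        · have hv' : v ∈ B := hv
          have hw' : w ∈ B := hw
          simp only [dif_pos hv', dif_pos hw'] at hvw
          simpa using e₁.injective (Subtype.ext hvw)
        · rw [dif_pos hv]; exact (e₁ ⟨v, hv⟩).2
      by_cases hpB : p ∈ B
      · refine ⟨_, he₀ (e₀.trans (Equiv.swap (e₀ ⟨p, hpB⟩) ⟨q, hq⟩)), fun _ => ?_⟩
        simp [hpB]
      · exact ⟨_, he₀ e₀, fun h => absurd h hpB⟩
    refine ⟨fun v => if v ∈ s then f v else e v, ?_, ?_⟩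
    · have hcov : ∀ v, (∃ X ∈ 𝓑, v ∈ X) → v ∈ s ∨ v ∈ B := by
        rintro v ⟨X, hX, hv⟩
        by_cases hXB : X = B
        · exact Or.inr (hXB ▸ hv)
        · exact Or.inl ((hs' v).2 ⟨X, Finset.mem_erase.2 ⟨hXB, hX⟩, hv⟩)
      have hmix : ∀ v w, v ∈ s → w ∉ s → w ∈ B → f v ≠ e w := by
        intro v w hv hw hwB hvw
        obtain ⟨hpB, rfl⟩ := hav v hv (hvw ▸ he.2 w hwB)
        rw [← hqp hpB hv, ← hep hpB] at hvw
        exact hw (he.1 hpB hwB hvw ▸ hv)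
      intro v hv w hw hvw
      by_cases h1 : v ∈ s <;> by_cases h2 : w ∈ s <;> simp only [h1, h2, if_true, if_false] at hvw
      · exact hf ((hs' v).1 h1) ((hs' w).1 h2) hvw
      · exact absurd hvw (hmix v w h1 h2 ((hcov w hw).resolve_left h2))
      · exact absurd hvw.symm (hmix w v h2 h1 ((hcov v hv).resolve_left h1))
      · exact he.1 ((hcov v hv).resolve_left h1) ((hcov w hw).resolve_left h2) hvw
    · intro X hX
      by_cases hXB : X = B
      · subst hXB
        refine ⟨B', hB', fun v hv => ?_⟩
        by_cases h1 : v ∈ s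
        · obtain ⟨Y, hY, hvY⟩ := (hs' v).1 h1
          obtain ⟨hYX, hY⟩ := Finset.mem_erase.1 hY
          obtain rfl := hp Y hY hYX v hv hvY
          simp only [h1, if_true]
          rw [← hqp hv h1]
          exact hq
        · simp only [h1, if_false]
          exact he.2 v hv
      · obtain ⟨Y, hY, hXY⟩ := hfB X (Finset.mem_erase.2 ⟨hXB, hX⟩)
        refine ⟨Y, hY, fun v hv => ?_⟩
        have : v ∈ s := (hs' v).2 ⟨X, Finset.mem_erase.2 ⟨hXB, hX⟩, hv⟩
        simp only [this, if_true]
        exact hXY v hv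
  by_cases hps : p ∈ B ∧ p ∈ s
  · -- among the triples through `f p` fewer than `|s| + 1` meet another image point
    obtain ⟨X, hX, hpX⟩ := (hs' p).1 hps.2
    obtain ⟨Y, hY, hXY⟩ := hfB X hX
    have hdeg' := hdeg (f p) ⟨Y, hY, hXY p hpX⟩
    by_contra! hcon
    have hbad : ∀ B' ∈ H.filter fun B' => f p ∈ B', ∃ v ∈ s, f v ∈ B' ∧ v ≠ p := by
      intro B' hB'
      obtain ⟨hB'1, hB'2⟩ := Finset.mem_filter.1 hB'
      obtain ⟨v, hv, hvB, hvp⟩ := hcon B' hB'1 (f p) hB'2 fun _ _ => rfl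
      exact ⟨v, hv, hvB, hvp hps.1⟩
    choose! g hg using hbad
    have := Finset.card_le_card_of_injOn g (fun B' hB' => (hg B' hB').1) (by
      intro B₁ h₁ B₂ h₂ h12
      obtain ⟨k1, k2, k3⟩ := hg B₁ h₁
      obtain ⟨l1, l2, l3⟩ := hg B₂ h₂
      refine hH.eq_of_mem (f p) (f (g B₁)) ?_ B₁ (Finset.mem_filter.1 h₁).1 B₂
        (Finset.mem_filter.1 h₂).1 (Finset.mem_filter.1 h₁).2 k2 (Finset.mem_filter.1 h₂).2
        (h12 ▸ l2)
      intro hfe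
      exact k3 (hf ((hs' p).1 hps.2) ((hs' _).1 k1) hfe).symm)
    omega
  · -- at most `|s| n` triples meet the image, fewer than there are
    by_contra! hcon
    have hbad : ∀ B' ∈ H, ∃ x : W × W, x.1 ∈ s.image f ∧ x.1 ∈ B' ∧ x.2 ∈ B' ∧ x.1 ≠ x.2 := by
      intro B' hB'
      have hc := hH.card_eq B' hB'
      obtain ⟨q, hq⟩ : B'.Nonempty := Finset.card_pos.1 (by omega)
      obtain ⟨v, hv, hvB, -⟩ := hcon B' hB' q hq fun h1 h2 => absurd ⟨h1, h2⟩ hps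
      obtain ⟨w, hw, hwv⟩ := Finset.exists_mem_ne (by omega : 1 < B'.card) (f v)
      exact ⟨(f v, w), Finset.mem_image_of_mem _ hv, hvB, hw, hwv.symm⟩
    choose! g hg using hbad
    have h1 := Finset.card_le_card_of_injOn g
      (t := s.image f ×ˢ Finset.univ)
      (fun B' hB' => Finset.mem_product.2 ⟨(hg B' hB').1, Finset.mem_univ _⟩) (by
      intro B₁ h₁ B₂ h₂ h12
      obtain ⟨-, k2, k3, k4⟩ := hg B₁ h₁
      obtain ⟨-, l2, l3, -⟩ := hg B₂ h₂
      exact hH.eq_of_mem _ _ k4 B₁ h₁ B₂ h₂ k2 k3 (h12 ▸ l2) (h12 ▸ l3))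
    rw [Finset.card_product, Finset.card_univ] at h1
    have h2 : H.card ≤ s.card * Fintype.card W :=
      h1.trans (Nat.mul_le_mul_right _ Finset.card_image_le)
    have h3 : (H.card : ℝ) ≤ s.card * (Fintype.card W : ℝ) := by exact_mod_cast h2
    have h4 := hN₁ _ hW1
    have h5 : (0 : ℝ) < Fintype.card W := by exact_mod_cast lt_of_lt_of_le hN₁0 hW1
    have h6 := mul_le_mul_of_nonneg_right (hd.trans h3) h5.le
    nlinarith

end Embedding

/-! ### The cores embed into dense families -/

section Hosts

theorem injective_of_nodup_ofFn {V : Type*} {n : ℕ} {f : Fin n → V}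
    (h : (List.ofFn f).Nodup) : Function.Injective f := List.nodup_ofFn.1 h

theorem IsTriangle.swap {V : Type*} {H : Finset (Finset V)} {x y z x' y' z' : V}
    (h : IsTriangle H x y z x' y' z') : IsTriangle H y x z y' x' z' :=
  ⟨h.block_y, h.block_x, h.block_z.swap, h.ne⟩

theorem IsTriangle.rot {V : Type*} {H : Finset (Finset V)} (hH : IsLinearFamily H)
    {x y z x' y' z' : V} (h : IsTriangle H x y z x' y' z') : IsTriangle H y z x y' z' x' := by
  refine ⟨h.block_y.swap, h.block_z.swap, h.block_x, ?_⟩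
  have := h.nodup hH
  simp only [List.nodup_cons, List.mem_cons, not_or] at this
  exact this.1.2.2.1

/-- In a dense linear family, for any two of the six points of a triangle, some triangle has many
common neighbours of these two points. -/
theorem exists_triangle_commonNbrs {ε : ℝ} (hε : 0 < ε) (K : ℕ) :
    ∃ N : ℕ, ∀ (W : Type) [Fintype W] (H : Finset (Finset W)),
      N ≤ Fintype.card W → IsLinearFamily H → ε * (Fintype.card W : ℝ) ^ 2 ≤ H.card →
      ∀ i j : Fin 6, i ≠ j → ∃ h : Fin 6 → W,
        IsTriangle H (h 0) (h 1) (h 2) (h 3) (h 4) (h 5) ∧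
          K ≤ (commonNbrs H (h i) (h j)).card := by
  obtain ⟨N₁, hN₁⟩ := exists_rich_triangle hε K
  obtain ⟨N₂, hN₂⟩ := exists_triangle_corner_opposite hε K
  obtain ⟨N₃, hN₃⟩ := exists_triangle_sides hε K
  refine ⟨max N₁ (max N₂ N₃), fun W _ H hW hH hd => ?_⟩
  have hd' : ε * (Fintype.card W : ℝ) ^ 2 ≤ (blockTriples H).card :=
    hd.trans (by exact_mod_cast card_le_card_blockTriples hH)
  obtain ⟨x, y, z, x', y', z', ht, hx, hy, hz⟩ := hN₁ W H (by omega) hH hd'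
  obtain ⟨a, b, c, a', b', c', ht₂, hc⟩ := hN₂ W H (by omega) hH hd'
  obtain ⟨p, q, r, p', q', r', ht₃, hs⟩ := hN₃ W H (by omega) hH hd'
  have key : ∀ i j : Fin 6, i < j → ∃ h : Fin 6 → W,
        IsTriangle H (h 0) (h 1) (h 2) (h 3) (h 4) (h 5) ∧
          K ≤ (commonNbrs H (h i) (h j)).card := by
    intro i j hij
    fin_cases i <;> fin_cases j <;> first
      | exact absurd hij (by decide)
      | exact ⟨![x, y, z, x', y', z'], ht, hx.1⟩
      | exact ⟨![x, y, z, x', y', z'], ht, hx.2.1⟩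
      | exact ⟨![x, y, z, x', y', z'], ht, hx.2.2⟩
      | exact ⟨![x, y, z, x', y', z'], ht, hy.1⟩
      | exact ⟨![x, y, z, x', y', z'], ht, hy.2.1⟩
      | exact ⟨![x, y, z, x', y', z'], ht, hy.2.2⟩
      | exact ⟨![x, y, z, x', y', z'], ht, hz.1⟩
      | exact ⟨![x, y, z, x', y', z'], ht, hz.2.1⟩
      | exact ⟨![x, y, z, x', y', z'], ht, hz.2.2⟩
      | exact ⟨![a, b, c, a', b', c'], ht₂, hc⟩
      | exact ⟨![b, c, a, b', c', a'], ht₂.rot hH, hc⟩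
      | exact ⟨![c, a, b, c', a', b'], (ht₂.rot hH).rot hH, hc⟩
      | exact ⟨![p, q, r, p', q', r'], ht₃, hs⟩
      | exact ⟨![q, r, p, q', r', p'], ht₃.rot hH, hs⟩
      | exact ⟨![q, p, r, q', p', r'], ht₃.swap, hs⟩
  intro i j hij
  rcases lt_or_gt_of_ne hij with h | h
  · exact key i j h
  · obtain ⟨g, h1, h2⟩ := key j i h
    exact ⟨g, h1, by rwa [commonNbrs_comm]⟩

variable {V : Type*} {𝓑 : Finset (Finset V)}

theorem isDenseUnavoidable_triangle {x y z x' y' z' : V} (hnd : [x, y, z, x', y', z'].Nodup)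
    (h : ∀ X ∈ 𝓑, LiesIn X y z x' ∨ LiesIn X x z y' ∨ LiesIn X x y z') :
    IsDenseUnavoidable 𝓑 := by
  intro ε hε
  obtain ⟨N, hN⟩ := exists_triangle_commonNbrs hε 0
  refine ⟨N, fun W _ H hW hH _ hd => ?_⟩
  obtain ⟨g, hg, -⟩ := hN W H hW hH hd 0 1 (by decide)
  refine familyEmbeds_of_labelling ![x, y, z, x', y', z'] (injective_of_nodup_ofFn hnd) g
    (injective_of_nodup_ofFn (hg.nodup hH)) fun X hX => ?_
  rcases h X hX with h | h | h
  exacts [⟨1, 2, 3, h, hg.block_x⟩, ⟨0, 2, 4, h, hg.block_y⟩, ⟨0, 1, 5, h, hg.block_z⟩]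

/-- A triangle with two of its six points `v i`, `v j` joined by a path of two further blocks. -/
theorem isDenseUnavoidable_triangle_path {v : Fin 6 → V} {w e f : V} {i j : Fin 6} (hij : i ≠ j)
    (hnd : [v 0, v 1, v 2, v 3, v 4, v 5, w, e, f].Nodup)
    (h : ∀ X ∈ 𝓑, LiesIn X (v 1) (v 2) (v 3) ∨ LiesIn X (v 0) (v 2) (v 4) ∨
      LiesIn X (v 0) (v 1) (v 5) ∨ LiesIn X (v i) w e ∨ LiesIn X (v j) w f) :
    IsDenseUnavoidable 𝓑 := by
  intro ε hε
  -- `19 > 3 * 6`: the path has to avoid the six points of the triangle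
  obtain ⟨N, hN⟩ := exists_triangle_commonNbrs hε 19
  refine ⟨N, fun W _ H hW hH _ hd => ?_⟩
  classical
  obtain ⟨g, hg, hK⟩ := hN W H hW hH hd i j hij
  have hgnd := hg.nodup hH
  have hginj : Function.Injective g := injective_of_nodup_ofFn hgnd
  obtain ⟨a, b, c, hb, hc, h1, h2, h3, h4, h5, h6⟩ := exists_path_avoiding hH
    (Finset.univ.image g) (hginj.ne hij) (by
      have := Finset.card_image_le (s := Finset.univ) (f := g)
      rw [Finset.card_univ, Fintype.card_fin] at this
      omega)
  have hout : ∀ u ∉ Finset.univ.image g, ∀ k, g k ≠ u := by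
    rintro u hu k rfl
    exact hu (Finset.mem_image_of_mem _ (Finset.mem_univ _))
  have hP : ∀ k : Fin 6, ![v 0, v 1, v 2, v 3, v 4, v 5, w, e, f]
      (Fin.castLE (by omega) k) = v k := by
    intro k; fin_cases k <;> rfl
  have hG : ∀ k : Fin 6, ![g 0, g 1, g 2, g 3, g 4, g 5, a, b, c]
      (Fin.castLE (by omega) k) = g k := by
    intro k; fin_cases k <;> rfl
  refine familyEmbeds_of_labelling ![v 0, v 1, v 2, v 3, v 4, v 5, w, e, f]
    (injective_of_nodup_ofFn hnd) ![g 0, g 1, g 2, g 3, g 4, g 5, a, b, c]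
    (injective_of_nodup_ofFn (?_ : [g 0, g 1, g 2, g 3, g 4, g 5, a, b, c].Nodup)) fun X hX => ?_
  · simp only [List.nodup_cons, List.mem_cons, List.not_mem_nil, not_or, not_false_eq_true,
      List.nodup_nil, and_true, or_false] at hgnd ⊢
    have o1 := hout a h1
    have o2 := hout b h2
    have o3 := hout c h3
    simp [hgnd, o1, o2, o3, h4, h5, h6]
  · rcases h X hX with h | h | h | h | h
    · exact ⟨1, 2, 3, h, hg.block_x⟩
    · exact ⟨0, 2, 4, h, hg.block_y⟩
    · exact ⟨0, 1, 5, h, hg.block_z⟩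
    · exact ⟨Fin.castLE (by omega) i, 6, 7, by rw [hP]; exact h, by rw [hG]; exact hb⟩
    · exact ⟨Fin.castLE (by omega) j, 6, 8, by rw [hP]; exact h, by rw [hG]; exact hc⟩

/-- A cycle of four blocks is part of a triangle with two of its corners joined by a path. -/
theorem isDenseUnavoidable_four_cycle {a b c d ab bc cd da : V}
    (hnd : [a, b, c, d, ab, bc, cd, da].Nodup)
    (h : ∀ X ∈ 𝓑, LiesIn X a b ab ∨ LiesIn X b c bc ∨ LiesIn X c d cd ∨ LiesIn X d a da) :
    IsDenseUnavoidable 𝓑 := by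
  intro ε hε
  -- `19 > 3 * 6`: the path has to avoid the six points of the triangle
  obtain ⟨N, hN⟩ := exists_triangle_commonNbrs hε 19
  refine ⟨N, fun W _ H hW hH _ hd => ?_⟩
  classical
  obtain ⟨g, hg, hK⟩ := hN W H hW hH hd 0 1 (by decide)
  have hgnd := hg.nodup hH
  have hginj : Function.Injective g := injective_of_nodup_ofFn hgnd
  obtain ⟨w, e, f, hb, hc, h1, h2, h3, h4, h5, h6⟩ := exists_path_avoiding hH
    (Finset.univ.image g) (hginj.ne (show (0 : Fin 6) ≠ 1 by decide)) (by
      have := Finset.card_image_le (s := Finset.univ) (f := g)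
      rw [Finset.card_univ, Fintype.card_fin] at this
      omega)
  have hout : ∀ u ∉ Finset.univ.image g, ∀ k, g k ≠ u := by
    rintro u hu k rfl
    exact hu (Finset.mem_image_of_mem _ (Finset.mem_univ _))
  refine familyEmbeds_of_labelling ![a, b, c, d, ab, bc, cd, da]
    (injective_of_nodup_ofFn hnd) ![g 0, g 2, g 1, w, g 4, g 3, f, e]
    (injective_of_nodup_ofFn (?_ : [g 0, g 2, g 1, w, g 4, g 3, f, e].Nodup)) fun X hX => ?_
  · simp only [List.nodup_cons, List.mem_cons, List.not_mem_nil, not_or, not_false_eq_true,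
      List.nodup_nil, and_true, or_false]
    have o1 := hout w h1
    have o2 := hout e h2
    have o3 := hout f h3
    simp [hginj.eq_iff, o1, o2, o3, h4, h5, h6.symm, fun k => (o1 k).symm]
  · rcases h X hX with h | h | h | h
    · exact ⟨0, 1, 4, h, hg.block_y⟩
    · exact ⟨1, 2, 5, h, hg.block_x.swap⟩
    · exact ⟨2, 3, 6, h, hc⟩
    · exact ⟨3, 0, 7, h, hb.swap⟩

/-- A cycle of five blocks arises from a triangle with rich blocks by replacing two of its blocks
by paths. -/
theorem isDenseUnavoidable_five_cycle {a b c d e ab bc cd de ea : V}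
    (hnd : [a, b, c, d, e, ab, bc, cd, de, ea].Nodup)
    (h : ∀ X ∈ 𝓑, LiesIn X a b ab ∨ LiesIn X b c bc ∨ LiesIn X c d cd ∨ LiesIn X d e de ∨
      LiesIn X e a ea) : IsDenseUnavoidable 𝓑 := by
  intro ε hε
  -- `28 > 3 * 9`: the second path has to avoid the triangle and the first path
  obtain ⟨N, hN⟩ := exists_rich_triangle hε 28
  refine ⟨N, fun W _ H hW hH _ hd => ?_⟩
  classical
  have hd' : ε * (Fintype.card W : ℝ) ^ 2 ≤ (blockTriples H).card :=
    hd.trans (by exact_mod_cast card_le_card_blockTriples hH)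
  obtain ⟨x, y, z, x', y', z', ht, -, hy, hz⟩ := hN W H hW hH hd'
  have hnd' := ht.nodup hH
  simp only [List.nodup_cons, List.mem_cons, List.not_mem_nil, not_or, not_false_eq_true,
    List.nodup_nil, and_true, or_false] at hnd'
  obtain ⟨w₁, b₁, c₁, hb₁, hc₁, k1, k2, k3, k4, k5, k6⟩ := exists_path_avoiding hH
    ([x, y, z, x', y', z'].toFinset) ht.block_z.1 (by
      have := List.toFinset_card_le [x, y, z, x', y', z']
      have := hz.1
      simp only [List.length_cons, List.length_nil] at *
      omega)
  obtain ⟨w₂, b₂, c₂, hb₂, hc₂, l1, l2, l3, l4, l5, l6⟩ := exists_path_avoiding hH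
    ([x, y, z, x', y', z', w₁, b₁, c₁].toFinset) ht.block_y.1 (by
      have := List.toFinset_card_le [x, y, z, x', y', z', w₁, b₁, c₁]
      have := hy.1
      simp only [List.length_cons, List.length_nil] at *
      omega)
  simp only [List.mem_toFinset, List.mem_cons, List.not_mem_nil, or_false, not_or]
    at k1 k2 k3 l1 l2 l3
  refine familyEmbeds_of_labelling ![a, b, c, d, e, ab, bc, cd, de, ea]
    (injective_of_nodup_ofFn hnd) ![y, z, w₂, x, w₁, x', c₂, b₂, b₁, c₁]
    (injective_of_nodup_ofFn (?_ : [y, z, w₂, x, w₁, x', c₂, b₂, b₁, c₁].Nodup)) fun X hX => ?_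
  · simp only [List.nodup_cons, List.mem_cons, List.not_mem_nil, not_or, not_false_eq_true,
      List.nodup_nil, and_true, or_false]
    grind
  · rcases h X hX with h | h | h | h | h
    · exact ⟨0, 1, 5, h, ht.block_x⟩
    · exact ⟨1, 2, 6, h, hc₂⟩
    · exact ⟨2, 3, 7, h, hb₂.swap⟩
    · exact ⟨3, 4, 8, h, hb₁⟩
    · exact ⟨4, 0, 9, h, hc₁.swap⟩

/-- Two disjoint blocks joined by three blocks. -/
theorem isDenseUnavoidable_ladder {x y z x' y' g p q r : V}
    (hnd : [x, y, z, x', y', g, p, q, r].Nodup)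
    (h : ∀ X ∈ 𝓑, LiesIn X x y z ∨ LiesIn X x' y' g ∨ LiesIn X x y' p ∨ LiesIn X y g q ∨
      LiesIn X z x' r) : IsDenseUnavoidable 𝓑 := by
  intro ε hε
  obtain ⟨N, hN⟩ := exists_ladder hε
  refine ⟨N, fun W _ H hW hH _ hd => ?_⟩
  have hd' : ε * (Fintype.card W : ℝ) ^ 2 ≤ (blockTriples H).card :=
    hd.trans (by exact_mod_cast card_le_card_blockTriples hH)
  obtain ⟨x₁, y₁, z₁, x₁', y₁', g₁, p₁, q₁, r₁, b₁, b₂, b₃, b₄, b₅, hnd₁⟩ := hN W H hW hH hd'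
  refine familyEmbeds_of_labelling ![x, y, z, x', y', g, p, q, r]
    (injective_of_nodup_ofFn hnd) ![x₁, y₁, z₁, x₁', y₁', g₁, p₁, q₁, r₁]
    (injective_of_nodup_ofFn hnd₁) fun X hX => ?_
  rcases h X hX with h | h | h | h | h
  exacts [⟨0, 1, 2, h, b₁⟩, ⟨3, 4, 5, h, b₂⟩, ⟨0, 4, 6, h, b₃⟩, ⟨1, 5, 7, h, b₄⟩,
    ⟨2, 3, 8, h, b₅⟩]

end Hosts

/-! ### Classification of the cores with at most five blocks -/

/-- A block through two points of a triangle is a block of that triangle. -/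
def TriangleSparse {V : Type*} (𝓑 : Finset (Finset V)) : Prop :=
  ∀ v : Fin 6 → V, IsTriangle 𝓑 (v 0) (v 1) (v 2) (v 3) (v 4) (v 5) → ∀ E ∈ 𝓑, ∀ i j, i ≠ j →
    v i ∈ E → v j ∈ E →
    LiesIn E (v 1) (v 2) (v 3) ∨ LiesIn E (v 0) (v 2) (v 4) ∨ LiesIn E (v 0) (v 1) (v 5)

/-- Every member of the family meets the others in at least two points. -/
def IsCore {V : Type*} (𝓑 : Finset (Finset V)) : Prop :=
  ∀ B ∈ 𝓑, ∀ p, ∃ B' ∈ 𝓑, B' ≠ B ∧ ∃ q, q ∈ B ∧ q ∈ B' ∧ q ≠ p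

/-- Four blocks in cyclic order, with consecutive blocks meeting in `p, p', r, q` and opposite
blocks disjoint. -/
structure IsFourCycle {V : Type*} (𝓑 : Finset (Finset V)) (A B E D : Finset V)
    (p p' r q : V) : Prop where
  memA : A ∈ 𝓑
  memB : B ∈ 𝓑
  memE : E ∈ 𝓑
  memD : D ∈ 𝓑
  pA : p ∈ A
  pB : p ∈ B
  p'B : p' ∈ B
  p'E : p' ∈ E
  rE : r ∈ E
  rD : r ∈ D
  qD : q ∈ D
  qA : q ∈ A
  disjAE : ∀ s, s ∈ A → s ∉ E
  disjBD : ∀ s, s ∈ B → s ∉ D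

section Cores

variable {V : Type*} {𝓑 : Finset (Finset V)}

theorem eq_of_card_le_five {α : Type*} {s : Finset α} (hs : s.card ≤ 5) {a b c d e : α}
    (ha : a ∈ s) (hb : b ∈ s) (hc : c ∈ s) (hd : d ∈ s) (he : e ∈ s)
    (hnd : [a, b, c, d, e].Nodup) {x : α} (hx : x ∈ s) :
    x = a ∨ x = b ∨ x = c ∨ x = d ∨ x = e := by
  classical
  have h1 : [a, b, c, d, e].toFinset ⊆ s := by
    intro y hy
    simp only [List.mem_toFinset, List.mem_cons, List.not_mem_nil, or_false] at hy
    rcases hy with rfl | rfl | rfl | rfl | rfl <;> assumption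
  have h2 := Finset.eq_of_subset_of_card_le h1
    (by rw [List.toFinset_card_of_nodup hnd]; exact hs)
  rw [← h2] at hx
  simpa using hx

theorem IsFourCycle.rot {A B E D : Finset V} {p p' r q : V}
    (h : IsFourCycle 𝓑 A B E D p p' r q) : IsFourCycle 𝓑 B E D A p' r q p :=
  ⟨h.memB, h.memE, h.memD, h.memA, h.p'B, h.p'E, h.rE, h.rD, h.qD, h.qA, h.pA, h.pB, h.disjBD,
    fun s hE hA => h.disjAE s hA hE⟩

/-- In the absence of triangles, three pairwise meeting blocks are concurrent. -/
theorem concurrent_of_no_triangle (h𝓑 : IsLinearFamily 𝓑)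
    (hnt : ∀ x y z x' y' z', ¬ IsTriangle 𝓑 x y z x' y' z') {X Y Z : Finset V}
    (hX : X ∈ 𝓑) (hY : Y ∈ 𝓑) (hZ : Z ∈ 𝓑) (hXY : X ≠ Y) (hYZ : Y ≠ Z) (hXZ : X ≠ Z) {a b c : V}
    (haX : a ∈ X) (haY : a ∈ Y) (hbY : b ∈ Y) (hbZ : b ∈ Z) (hcX : c ∈ X) (hcZ : c ∈ Z) :
    a = b ∧ b = c := by
  have key : ∀ S ∈ 𝓑, ∀ T ∈ 𝓑, S ≠ T → ∀ u ∈ S, u ∈ T → ∀ v ∈ S, v ∈ T → u = v := by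
    intro S hS T hT hne u hu hu' v hv hv'
    by_contra huv
    exact hne (h𝓑.eq_of_mem u v huv S hS T hT hu hv hu' hv')
  by_cases hab : a = b
  · subst hab
    exact ⟨rfl, key X hX Z hZ hXZ a haX hbZ c hcX hcZ⟩
  · exfalso
    have hac : a ≠ c := by
      rintro rfl; exact hab (key Y hY Z hZ hYZ a haY hcZ b hbY hbZ)
    have hbc : b ≠ c := by
      rintro rfl; exact hab (key X hX Y hY hXY a haX haY b hcX hbY)
    obtain ⟨x', -, hx', -⟩ := h𝓑.exists_third hZ hbZ hcZ hbc
    obtain ⟨y', -, hy', -⟩ := h𝓑.exists_third hX haX hcX hac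
    obtain ⟨z', hz'Y, hz', -⟩ := h𝓑.exists_third hY haY hbY hab
    refine hnt a b c x' y' z' ⟨hx', hy', hz', ?_⟩
    rintro rfl
    exact hac (key X hX Y hY hXY a haX haY c hcX hz'Y)

theorem eq_of_mem_of_mem (h𝓑 : IsLinearFamily 𝓑) {S T : Finset V} (hS : S ∈ 𝓑) (hT : T ∈ 𝓑)
    (hne : S ≠ T) {u v : V} (hu : u ∈ S) (hu' : u ∈ T) (hv : v ∈ S) (hv' : v ∈ T) : u = v := by
  by_contra huv
  exact hne (h𝓑.eq_of_mem u v huv S hS T hT hu hv hu' hv')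

/-- A core of at most five blocks that contains a triangle is the triangle, or has two more blocks
forming a path between two of its points. -/
theorem isDenseUnavoidable_of_triangle (h𝓑 : IsLinearFamily 𝓑) (hcard : 𝓑.card ≤ 5)
    (hsp : TriangleSparse 𝓑) (hcore : IsCore 𝓑) (v : Fin 6 → V)
    (hv : IsTriangle 𝓑 (v 0) (v 1) (v 2) (v 3) (v 4) (v 5)) : IsDenseUnavoidable 𝓑 := by
  have hnd := hv.nodup h𝓑
  have hinj : Function.Injective v := injective_of_nodup_ofFn hnd
  by_cases hall : ∀ X ∈ 𝓑, LiesIn X (v 1) (v 2) (v 3) ∨ LiesIn X (v 0) (v 2) (v 4) ∨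
      LiesIn X (v 0) (v 1) (v 5)
  · exact isDenseUnavoidable_triangle hnd hall
  push Not at hall
  obtain ⟨E, hE, hE1, hE2, hE3⟩ := hall
  have hEv : ∀ i j, v i ∈ E → v j ∈ E → i = j := by
    intro i j hi hj
    by_contra hij
    rcases hsp v hv E hE i j hij hi hj with h | h | h
    exacts [hE1 h, hE2 h, hE3 h]
  -- the block `F` meets `E` in a point `w` outside the triangle
  obtain ⟨F, hF, hFE, w, hwE, hwF, hwv⟩ :
      ∃ F ∈ 𝓑, F ≠ E ∧ ∃ w, w ∈ E ∧ w ∈ F ∧ ∀ i, w ≠ v i := by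
    by_cases h : ∃ i, v i ∈ E
    · obtain ⟨i, hi⟩ := h
      obtain ⟨F, hF, hFE, w, h1, h2, h3⟩ := hcore E hE (v i)
      refine ⟨F, hF, hFE, w, h1, h2, ?_⟩
      rintro j rfl
      exact h3 (congrArg v (hEv j i h1 hi))
    · push Not at h
      obtain ⟨F, hF, hFE, w, h1, h2, h3⟩ := hcore E hE (v 0)
      exact ⟨F, hF, hFE, w, h1, h2, by rintro j rfl; exact h j h1⟩
  obtain ⟨⟨-, -, -, A, hA, hA1, hA2, hA3⟩, ⟨-, -, -, B, hB, hB1, hB2, hB3⟩,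
    ⟨-, -, -, D, hD, hD1, hD2, hD3⟩, -⟩ := id hv
  have mA := h𝓑.mem_iff hA hv.block_x.1 hv.block_x.2.1 hv.block_x.2.2.1 hA1 hA2 hA3
  have mB := h𝓑.mem_iff hB hv.block_y.1 hv.block_y.2.1 hv.block_y.2.2.1 hB1 hB2 hB3
  have mD := h𝓑.mem_iff hD hv.block_z.1 hv.block_z.2.1 hv.block_z.2.2.1 hD1 hD2 hD3
  have hwA : w ∉ A := fun h => by rcases (mA w).1 h with h | h | h <;> exact hwv _ h
  have hwB : w ∉ B := fun h => by rcases (mB w).1 h with h | h | h <;> exact hwv _ h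
  have hwD : w ∉ D := fun h => by rcases (mD w).1 h with h | h | h <;> exact hwv _ h
  have hAB : A ≠ B := by
    rintro rfl
    rcases (mA (v 0)).1 hB1 with h | h | h <;> exact absurd (hinj h) (by decide)
  have hAD : A ≠ D := by
    rintro rfl
    rcases (mA (v 0)).1 hD1 with h | h | h <;> exact absurd (hinj h) (by decide)
  have hBD : B ≠ D := by
    rintro rfl
    rcases (mB (v 1)).1 hD2 with h | h | h <;> exact absurd (hinj h) (by decide)
  have hAE : A ≠ E := by rintro rfl; exact hwA hwE
  have hBE : B ≠ E := by rintro rfl; exact hwB hwE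
  have hDE : D ≠ E := by rintro rfl; exact hwD hwE
  have hAF : A ≠ F := by rintro rfl; exact hwA hwF
  have hBF : B ≠ F := by rintro rfl; exact hwB hwF
  have hDF : D ≠ F := by rintro rfl; exact hwD hwF
  have hfive : ∀ X ∈ 𝓑, X = A ∨ X = B ∨ X = D ∨ X = E ∨ X = F := fun X hX =>
    eq_of_card_le_five hcard hA hB hD hE hF
      (by simp [hAB, hAD, hBD, hAE, hBE, hDE, hAF, hBF, hDF, hFE.symm]) hX
  have hABD : ∀ q, q ∈ A ∨ q ∈ B ∨ q ∈ D → ∃ i, q = v i := by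
    rintro q (h | h | h)
    · rcases (mA q).1 h with h | h | h <;> exact ⟨_, h⟩
    · rcases (mB q).1 h with h | h | h <;> exact ⟨_, h⟩
    · rcases (mD q).1 h with h | h | h <;> exact ⟨_, h⟩
  -- both `E` and `F` meet the triangle
  obtain ⟨i, hi⟩ : ∃ i, v i ∈ E := by
    obtain ⟨X, hX, hXE, q, hq1, hq2, hq3⟩ := hcore E hE w
    have : ∃ i, q = v i := by
      rcases hfive X hX with rfl | rfl | rfl | rfl | rfl
      · exact hABD q (Or.inl hq2)
      · exact hABD q (Or.inr (Or.inl hq2))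
      · exact hABD q (Or.inr (Or.inr hq2))
      · exact absurd rfl hXE
      · exact absurd (eq_of_mem_of_mem h𝓑 hE hF hFE.symm hq1 hq2 hwE hwF) hq3
    obtain ⟨i, rfl⟩ := this
    exact ⟨i, hq1⟩
  obtain ⟨j, hj⟩ : ∃ j, v j ∈ F := by
    obtain ⟨X, hX, hXF, q, hq1, hq2, hq3⟩ := hcore F hF w
    have : ∃ i, q = v i := by
      rcases hfive X hX with rfl | rfl | rfl | rfl | rfl
      · exact hABD q (Or.inl hq2)
      · exact hABD q (Or.inr (Or.inl hq2))
      · exact hABD q (Or.inr (Or.inr hq2))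
      · exact absurd (eq_of_mem_of_mem h𝓑 hE hF hFE.symm hq2 hq1 hwE hwF) hq3
      · exact absurd rfl hXF
    obtain ⟨i, rfl⟩ := this
    exact ⟨i, hq1⟩
  have hFv : ∀ i j, v i ∈ F → v j ∈ F → i = j := by
    intro i j hi hj
    by_contra hij
    rcases hsp v hv F hF i j hij hi hj with h | h | h <;>
      rcases h w hwF with h | h | h <;> exact hwv _ h
  have hij : i ≠ j := by
    rintro rfl
    exact hwv i (eq_of_mem_of_mem h𝓑 hE hF hFE.symm hwE hwF hi hj)
  obtain ⟨e, heE, he, mE⟩ := h𝓑.exists_third hE hi hwE (hwv i).symm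
  obtain ⟨f, hfF, hf, mF⟩ := h𝓑.exists_third hF hj hwF (hwv j).symm
  have hev : ∀ k, e ≠ v k := by
    rintro k rfl
    exact he.2.2.1 (congrArg v (hEv i k hi heE))
  have hfv : ∀ k, f ≠ v k := by
    rintro k rfl
    exact hf.2.2.1 (congrArg v (hFv j k hj hfF))
  have hef : e ≠ f := by
    rintro rfl
    exact he.2.1 (eq_of_mem_of_mem h𝓑 hE hF hFE.symm hwE hwF heE hfF)
  refine isDenseUnavoidable_triangle_path (v := v) (w := w) (e := e) (f := f) hij ?_ ?_
  · simp [hinj.eq_iff, fun k => (hwv k).symm, fun k => (hev k).symm, fun k => (hfv k).symm,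
      he.2.1, hf.2.1, hef]
  · intro X hX
    rcases hfive X hX with rfl | rfl | rfl | rfl | rfl
    · exact Or.inl fun u hu => (mA u).1 hu
    · exact Or.inr (Or.inl fun u hu => (mB u).1 hu)
    · exact Or.inr (Or.inr (Or.inl fun u hu => (mD u).1 hu))
    · exact Or.inr (Or.inr (Or.inr (Or.inl fun u hu => (mE u).1 hu)))
    · exact Or.inr (Or.inr (Or.inr (Or.inr fun u hu => (mF u).1 hu)))

/-- Four blocks in a cycle without triangles, together with a fifth block meeting two opposite
ones. -/
theorem isDenseUnavoidable_of_four_cycle_chord (h𝓑 : IsLinearFamily 𝓑)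
    (hnt : ∀ x y z x' y' z', ¬ IsTriangle 𝓑 x y z x' y' z')
    {A B E D F : Finset V} {p p' r q s t : V}
    (hc : IsFourCycle 𝓑 A B E D p p' r q) (hF : F ∈ 𝓑)
    (hFA : F ≠ A) (hFB : F ≠ B) (hFE : F ≠ E) (hFD : F ≠ D)
    (hall : ∀ X ∈ 𝓑, X = A ∨ X = B ∨ X = E ∨ X = D ∨ X = F)
    (hsF : s ∈ F) (hsA : s ∈ A) (htF : t ∈ F) (htE : t ∈ E) : IsDenseUnavoidable 𝓑 := by
  obtain ⟨hA, hB, hE, hD, pA, pB, p'B, p'E, rE, rD, qD, qA, dAE, dBD⟩ := hc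
  have hAB : A ≠ B := by rintro rfl; exact dAE p' p'B p'E
  have hBE : B ≠ E := by rintro rfl; exact dAE p pA pB
  have hED : E ≠ D := by rintro rfl; exact dAE q qA qD
  have hDA : D ≠ A := by rintro rfl; exact dAE r rD rE
  have dFB : ∀ u, u ∈ F → u ∉ B := by
    intro u huF huB
    obtain ⟨h1, h2⟩ := concurrent_of_no_triangle h𝓑 hnt hF hA hB hFA hAB hFB hsF hsA pA pB huF huB
    obtain ⟨h3, h4⟩ := concurrent_of_no_triangle h𝓑 hnt hF hE hB hFE hBE.symm hFB htF htE p'E p'B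
      huF huB
    exact dAE p pA (by rw [h2, ← h4]; exact p'E)
  have dFD : ∀ u, u ∈ F → u ∉ D := by
    intro u huF huD
    obtain ⟨h1, h2⟩ := concurrent_of_no_triangle h𝓑 hnt hF hA hD hFA hDA.symm hFD hsF hsA qA qD
      huF huD
    obtain ⟨h3, h4⟩ := concurrent_of_no_triangle h𝓑 hnt hF hE hD hFE hED hFD htF htE rE rD
      huF huD
    exact dAE q qA (by rw [h2, ← h4]; exact rE)
  have hpq : p ≠ q := by rintro rfl; exact dBD p pB qD
  have hps : p ≠ s := by rintro rfl; exact dFB p hsF pB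
  have hsq : s ≠ q := by rintro rfl; exact dFD s hsF qD
  have hp'r : r ≠ p' := by rintro rfl; exact dBD r p'B rD
  have hp't : p' ≠ t := by rintro rfl; exact dFB p' htF p'B
  have hrt : r ≠ t := by rintro rfl; exact dFD r htF rD
  have hpp' : p ≠ p' := by rintro rfl; exact dAE p pA p'E
  have hqr : q ≠ r := by rintro rfl; exact dAE q qA rE
  have hst : s ≠ t := by rintro rfl; exact dAE s hsA htE
  have mA := h𝓑.mem_iff hA hps hsq hpq pA hsA qA
  have mE := h𝓑.mem_iff hE hp'r hp't hrt rE p'E htE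
  obtain ⟨b, bB, hb, mB⟩ := h𝓑.exists_third hB pB p'B hpp'
  obtain ⟨f, fF, hf, mF⟩ := h𝓑.exists_third hF hsF htF hst
  obtain ⟨d, dD, hd, mD⟩ := h𝓑.exists_third hD qD rD hqr
  have hbA : b ∉ A := fun h => hb.2.2.1 (eq_of_mem_of_mem h𝓑 hA hB hAB pA pB h bB)
  have hbE : b ∉ E := fun h => hb.2.1 (eq_of_mem_of_mem h𝓑 hB hE hBE p'B p'E bB h)
  have hfA : f ∉ A := fun h => hf.2.2.1 (eq_of_mem_of_mem h𝓑 hF hA hFA hsF hsA fF h)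
  have hfE : f ∉ E := fun h => hf.2.1 (eq_of_mem_of_mem h𝓑 hF hE hFE htF htE fF h)
  have hdA : d ∉ A := fun h => hd.2.2.1 (eq_of_mem_of_mem h𝓑 hD hA hDA qD qA dD h)
  have hdE : d ∉ E := fun h => hd.2.1 (eq_of_mem_of_mem h𝓑 hE hD hED rE rD h dD)
  refine isDenseUnavoidable_ladder (x := p) (y := s) (z := q) (x' := r) (y' := p') (g := t)
    (p := b) (q := f) (r := d) ?_ ?_
  · simp only [List.nodup_cons, List.mem_cons, List.not_mem_nil, not_or, not_false_eq_true,
      List.nodup_nil, and_true, or_false]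
    grind
  · intro X hX
    rcases hall X hX with rfl | rfl | rfl | rfl | rfl
    · exact Or.inl fun u hu => (mA u).1 hu
    · exact Or.inr (Or.inr (Or.inl fun u hu => (mB u).1 hu))
    · exact Or.inr (Or.inl fun u hu => (mE u).1 hu)
    · exact Or.inr (Or.inr (Or.inr (Or.inr fun u hu => (mD u).1 hu)))
    · exact Or.inr (Or.inr (Or.inr (Or.inl fun u hu => (mF u).1 hu)))

/-- A core of at most five blocks without triangles that contains a four-cycle is the four-cycle,
or has one more block joining two opposite blocks of it. -/
theorem isDenseUnavoidable_of_four_cycle (h𝓑 : IsLinearFamily 𝓑) (hcard : 𝓑.card ≤ 5)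
    (hnt : ∀ x y z x' y' z', ¬ IsTriangle 𝓑 x y z x' y' z') (hcore : IsCore 𝓑)
    {A B E D : Finset V} {p p' r q : V}
    (hc : IsFourCycle 𝓑 A B E D p p' r q) : IsDenseUnavoidable 𝓑 := by
  obtain ⟨hA, hB, hE, hD, pA, pB, p'B, p'E, rE, rD, qD, qA, dAE, dBD⟩ := id hc
  have hAB : A ≠ B := by rintro rfl; exact dAE p' p'B p'E
  have hBE : B ≠ E := by rintro rfl; exact dAE p pA pB
  have hED : E ≠ D := by rintro rfl; exact dAE q qA qD
  have hDA : D ≠ A := by rintro rfl; exact dAE r rD rE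
  have hAE : A ≠ E := by rintro rfl; exact dAE p pA pA
  have hBD : B ≠ D := by rintro rfl; exact dBD p pB pB
  by_cases hall : ∀ X ∈ 𝓑, X = A ∨ X = B ∨ X = E ∨ X = D
  · have hpq : q ≠ p := by rintro rfl; exact dBD q pB qD
    have hrp' : p' ≠ r := by rintro rfl; exact dBD p' p'B rD
    have hpp' : p ≠ p' := by rintro rfl; exact dAE p pA p'E
    have hqr : r ≠ q := by rintro rfl; exact dAE r qA rE
    obtain ⟨b, bB, hb, mB⟩ := h𝓑.exists_third hB pB p'B hpp'
    obtain ⟨e, eE, he, mE⟩ := h𝓑.exists_third hE p'E rE hrp'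
    obtain ⟨d, dD, hd, mD⟩ := h𝓑.exists_third hD rD qD hqr
    obtain ⟨a, aA, ha, mA⟩ := h𝓑.exists_third hA qA pA hpq
    have hbA : b ∉ A := fun h => hb.2.2.1 (eq_of_mem_of_mem h𝓑 hA hB hAB pA pB h bB)
    have hbE : b ∉ E := fun h => hb.2.1 (eq_of_mem_of_mem h𝓑 hB hE hBE p'B p'E bB h)
    have hdA : d ∉ A := fun h => hd.2.1 (eq_of_mem_of_mem h𝓑 hD hA hDA qD qA dD h)
    have hdE : d ∉ E := fun h => hd.2.2.1 (eq_of_mem_of_mem h𝓑 hE hD hED rE rD h dD)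
    have hbD := dBD b bB
    refine isDenseUnavoidable_four_cycle (a := p) (b := p') (c := r) (d := q)
      (ab := b) (bc := e) (cd := d) (da := a) ?_ ?_
    · obtain ⟨ha1, ha2, ha3, -⟩ := ha
      obtain ⟨hb1, hb2, hb3, -⟩ := hb
      obtain ⟨hd1, hd2, hd3, -⟩ := hd
      obtain ⟨he1, he2, he3, -⟩ := he
      simp only [List.nodup_cons, List.mem_cons, List.not_mem_nil, not_or, not_false_eq_true,
        List.nodup_nil, and_true, or_false]
      grind
    · intro X hX
      rcases hall X hX with rfl | rfl | rfl | rfl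
      · exact Or.inr (Or.inr (Or.inr fun u hu => (mA u).1 hu))
      · exact Or.inl fun u hu => (mB u).1 hu
      · exact Or.inr (Or.inl fun u hu => (mE u).1 hu)
      · exact Or.inr (Or.inr (Or.inl fun u hu => (mD u).1 hu))
  · push Not at hall
    obtain ⟨F, hF, hFA, hFB, hFE, hFD⟩ := hall
    have hfive : ∀ X ∈ 𝓑, X = A ∨ X = B ∨ X = E ∨ X = D ∨ X = F := fun X hX =>
      eq_of_card_le_five hcard hA hB hE hD hF
        (by simp [hAB, hAE, hBE, hED, hDA.symm, hBD, hFA.symm, hFB.symm, hFE.symm, hFD.symm]) hX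
    obtain ⟨X, hX, hXF, s, hsF, hsX, -⟩ := hcore F hF p
    obtain ⟨Y, hY, hYF, t, htF, htY, hts⟩ := hcore F hF s
    have hXY : X ≠ Y := by
      rintro rfl
      exact hts (eq_of_mem_of_mem h𝓑 hF hX hXF.symm htF htY hsF hsX)
    -- consecutive blocks of the cycle would form a triangle with `F`
    have hadj : ∀ c, c ∈ X → c ∉ Y := by
      intro c hcX hcY
      obtain ⟨h1, h2⟩ := concurrent_of_no_triangle h𝓑 hnt hF hX hY hXF.symm hXY hYF.symm hsF hsX
        hcX hcY htF htY
      exact hts (h2.symm.trans h1.symm)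
    rcases hfive X hX with rfl | rfl | rfl | rfl | rfl
    · rcases hfive Y hY with rfl | rfl | rfl | rfl | rfl
      · exact absurd rfl hXY
      · exact absurd pB (hadj p pA)
      · exact isDenseUnavoidable_of_four_cycle_chord h𝓑 hnt hc hF hFA hFB hFE hFD hfive
          hsF hsX htF htY
      · exact absurd qD (hadj q qA)
      · exact absurd rfl hYF
    · rcases hfive Y hY with rfl | rfl | rfl | rfl | rfl
      · exact absurd pA (hadj p pB)
      · exact absurd rfl hXY
      · exact absurd p'E (hadj p' p'B)
      · exact isDenseUnavoidable_of_four_cycle_chord h𝓑 hnt hc.rot hF hFB hFE hFD hFA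
          (fun Z hZ => by rcases hfive Z hZ with h | h | h | h | h <;> simp [h]) hsF hsX htF htY
      · exact absurd rfl hYF
    · rcases hfive Y hY with rfl | rfl | rfl | rfl | rfl
      · exact isDenseUnavoidable_of_four_cycle_chord h𝓑 hnt hc hF hFA hFB hFE hFD hfive
          htF htY hsF hsX
      · exact absurd p'B (hadj p' p'E)
      · exact absurd rfl hXY
      · exact absurd rD (hadj r rE)
      · exact absurd rfl hYF
    · rcases hfive Y hY with rfl | rfl | rfl | rfl | rfl
      · exact absurd qA (hadj q qD)
      · exact isDenseUnavoidable_of_four_cycle_chord h𝓑 hnt hc.rot hF hFB hFE hFD hFA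
          (fun Z hZ => by rcases hfive Z hZ with h | h | h | h | h <;> simp [h]) htF htY hsF hsX
      · exact absurd rE (hadj r rD)
      · exact absurd rfl hXY
      · exact absurd rfl hYF
    · exact absurd rfl hXF

/-- A nonempty core of at most five blocks without triangles contains a four-cycle or is a
five-cycle. -/
theorem isDenseUnavoidable_of_no_triangle (h𝓑 : IsLinearFamily 𝓑) (hcard : 𝓑.card ≤ 5)
    (hnt : ∀ x y z x' y' z', ¬ IsTriangle 𝓑 x y z x' y' z') (hcore : IsCore 𝓑)
    (hne : 𝓑.Nonempty) : IsDenseUnavoidable 𝓑 := by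
  obtain ⟨A, hA⟩ := hne
  obtain ⟨o, -⟩ : A.Nonempty := Finset.card_pos.1 (by rw [h𝓑.card_eq A hA]; omega)
  obtain ⟨B, hB, hBA, p, pA, pB, -⟩ := hcore A hA o
  obtain ⟨D, hD, hDA, q, qA, qD, hqp⟩ := hcore A hA p
  obtain ⟨E, hE, hEB, p', p'B, p'E, hp'p⟩ := hcore B hB p
  obtain ⟨F, hF, hFD, q', q'D, q'F, hq'q⟩ := hcore D hD q
  have dBD : ∀ s, s ∈ B → s ∉ D := by
    have hBD : B ≠ D := by
      rintro rfl; exact hqp (eq_of_mem_of_mem h𝓑 hA hB hBA.symm qA qD pA pB)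
    intro s sB sD
    obtain ⟨h1, h2⟩ := concurrent_of_no_triangle h𝓑 hnt hA hB hD hBA.symm hBD hDA.symm
      pA pB sB sD qA qD
    exact hqp (h2.symm.trans h1.symm)
  have hBD : B ≠ D := by rintro rfl; exact dBD p pB pB
  have hEA : E ≠ A := by
    rintro rfl; exact hp'p (eq_of_mem_of_mem h𝓑 hA hB hBA.symm p'E p'B pA pB)
  have dAE : ∀ s, s ∈ A → s ∉ E := by
    intro s sA sE
    exact hp'p (concurrent_of_no_triangle h𝓑 hnt hA hB hE hBA.symm hEB.symm hEA.symm
      pA pB p'B p'E sA sE).1.symm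
  have hED : E ≠ D := by rintro rfl; exact dAE q qA qD
  by_cases hr : ∃ r, r ∈ E ∧ r ∈ D
  · obtain ⟨r, rE, rD⟩ := hr
    exact isDenseUnavoidable_of_four_cycle h𝓑 hcard hnt hcore
      (A := A) (B := B) (E := E) (D := D) (p := p) (p' := p') (r := r) (q := q)
      ⟨hA, hB, hE, hD, pA, pB, p'B, p'E, rE, rD, qD, qA, dAE, dBD⟩
  push Not at hr
  have hFE : F ≠ E := by rintro rfl; exact hr q' q'F q'D
  have hFB : F ≠ B := by rintro rfl; exact dBD q' q'F q'D
  have hFA : F ≠ A := by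
    rintro rfl; exact hq'q (eq_of_mem_of_mem h𝓑 hF hD hFD q'F q'D qA qD)
  have hfive : ∀ X ∈ 𝓑, X = A ∨ X = B ∨ X = E ∨ X = F ∨ X = D := fun X hX =>
    eq_of_card_le_five hcard hA hB hE hF hD
      (by simp [hBA.symm, hEA.symm, hFA.symm, hDA.symm, hEB.symm, hFB.symm, hBD, hFE.symm, hED,
        hFD]) hX
  obtain ⟨r, rE, rF, hrp'⟩ : ∃ r, r ∈ E ∧ r ∈ F ∧ r ≠ p' := by
    obtain ⟨X, hX, hXE, r, rE, rX, hrp'⟩ := hcore E hE p'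
    rcases hfive X hX with rfl | rfl | rfl | rfl | rfl
    · exact absurd rE (dAE r rX)
    · exact absurd (eq_of_mem_of_mem h𝓑 hE hB hEB rE rX p'E p'B) hrp'
    · exact absurd rfl hXE
    · exact ⟨r, rE, rX, hrp'⟩
    · exact absurd rX (hr r rE)
  have dAF : ∀ s, s ∈ A → s ∉ F := by
    intro s sA sF
    exact hq'q (concurrent_of_no_triangle h𝓑 hnt hA hD hF hDA.symm hFD.symm hFA.symm
      qA qD q'D q'F sA sF).1.symm
  have dBF : ∀ s, s ∈ B → s ∉ F := by
    intro s sB sF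
    exact hrp' (concurrent_of_no_triangle h𝓑 hnt hB hE hF hEB.symm hFE.symm hFB.symm
      p'B p'E rE rF sB sF).1.symm
  have hq'r : r ≠ q' := by rintro rfl; exact hr r rE q'D
  obtain ⟨a, aA, ⟨ha1, ha2, ha3, -⟩, mA⟩ := h𝓑.exists_third hA qA pA hqp
  obtain ⟨b, bB, ⟨hb1, hb2, hb3, -⟩, mB⟩ := h𝓑.exists_third hB pB p'B hp'p.symm
  obtain ⟨e, eE, ⟨he1, he2, he3, -⟩, mE⟩ := h𝓑.exists_third hE p'E rE hrp'.symm
  obtain ⟨f, fF, ⟨hf1, hf2, hf3, -⟩, mF⟩ := h𝓑.exists_third hF rF q'F hq'r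
  obtain ⟨d, dD, ⟨hd1, hd2, hd3, -⟩, mD⟩ := h𝓑.exists_third hD q'D qD hq'q
  have hbA : b ∉ A := fun h => hb3 (eq_of_mem_of_mem h𝓑 hA hB hBA.symm pA pB h bB)
  have heB : e ∉ B := fun h => he3 (eq_of_mem_of_mem h𝓑 hB hE hEB.symm p'B p'E h eE)
  have hfE : f ∉ E := fun h => hf3 (eq_of_mem_of_mem h𝓑 hE hF hFE.symm rE rF h fF)
  have hdF : d ∉ F := fun h => hd3 (eq_of_mem_of_mem h𝓑 hF hD hFD q'F q'D h dD)
  have haD : a ∉ D := fun h => ha3 (eq_of_mem_of_mem h𝓑 hD hA hDA qD qA h aA)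
  have hbD := dBD b bB
  have hbF := dBF b bB
  have haE := dAE a aA
  have haF := dAF a aA
  have heD := hr e eE
  refine isDenseUnavoidable_five_cycle (a := p) (b := p') (c := r) (d := q') (e := q)
    (ab := b) (bc := e) (cd := f) (de := d) (ea := a) ?_ ?_
  · simp only [List.nodup_cons, List.mem_cons, List.not_mem_nil, not_or, not_false_eq_true,
      List.nodup_nil, and_true, or_false]
    grind
  · intro X hX
    rcases hfive X hX with rfl | rfl | rfl | rfl | rfl
    · exact Or.inr (Or.inr (Or.inr (Or.inr fun u hu => (mA u).1 hu)))
    · exact Or.inl fun u hu => (mB u).1 hu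
    · exact Or.inr (Or.inl fun u hu => (mE u).1 hu)
    · exact Or.inr (Or.inr (Or.inl fun u hu => (mF u).1 hu))
    · exact Or.inr (Or.inr (Or.inr (Or.inl fun u hu => (mD u).1 hu)))

theorem TriangleSparse.mono {𝓑' : Finset (Finset V)} (hs : 𝓑' ⊆ 𝓑) (h : TriangleSparse 𝓑) :
    TriangleSparse 𝓑' := fun v hv E hE =>
  h v ⟨hv.block_x.mono hs, hv.block_y.mono hs, hv.block_z.mono hs, hv.ne⟩ E (hs hE)

/-- A family of at most five blocks in which every triangle is sparse is unavoidable in dense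
families: remove blocks meeting the rest in at most one point until a core remains. -/
theorem TriangleSparse.isDenseUnavoidable (n : ℕ) : ∀ {𝓑 : Finset (Finset V)}, 𝓑.card = n →
    IsLinearFamily 𝓑 → 𝓑.card ≤ 5 → TriangleSparse 𝓑 → IsDenseUnavoidable 𝓑 := by
  classical
  induction n with
  | zero =>
    intro 𝓑 h0 _ _ _ ε _
    obtain rfl := Finset.card_eq_zero.1 h0
    refine ⟨1, fun W _ H hW _ _ _ => ?_⟩
    obtain ⟨w⟩ : Nonempty W := Fintype.card_pos_iff.1 hW
    exact ⟨fun _ => w, by intro v hv; simp at hv, by simp⟩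
  | succ n ih =>
    intro 𝓑 hn h𝓑 hcard hsp
    by_cases hcore : IsCore 𝓑
    · by_cases ht : ∃ x y z x' y' z', IsTriangle 𝓑 x y z x' y' z'
      · obtain ⟨x, y, z, x', y', z', ht⟩ := ht
        exact isDenseUnavoidable_of_triangle h𝓑 hcard hsp hcore ![x, y, z, x', y', z'] ht
      · push Not at ht
        exact isDenseUnavoidable_of_no_triangle h𝓑 hcard ht hcore
          (Finset.card_pos.1 (by omega))
    · unfold IsCore at hcore
      push Not at hcore
      obtain ⟨B, hB, p, hp⟩ := hcore
      have hc := Finset.card_erase_of_mem hB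
      exact IsDenseUnavoidable.of_erase hB (h𝓑.card_eq B hB) p
        (fun B' hB' hne q hq hq' => hp B' hB' hne q hq hq')
        (ih (by omega) (h𝓑.mono (Finset.erase_subset _ _)) (by omega)
          (hsp.mono (Finset.erase_subset _ _)))

end Cores

/-! ### Avoiding Steiner triple systems and the sail -/

section Avoiding

theorem TripleSystem.IsConfiguration.isLinearFamily {V : Type*} {C : TripleSystem V}
    (hC : C.IsConfiguration) : IsLinearFamily C.blocks :=
  ⟨C.card_block, hC.pair_unique⟩

open Classical in
/-- The triple system whose blocks are the triples of points with sum zero, the points being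
labelled by elements of an abelian group. -/
noncomputable def zeroSumSystem {W G : Type} [Fintype W] [AddCommGroup G] (φ : W → G) :
    TripleSystem W where
  blocks := Finset.univ.filter fun B => B.card = 3 ∧ ∑ b ∈ B, φ b = 0
  card_block _ hB := (Finset.mem_filter.1 hB).2.1

theorem zeroSumSystem_isSteiner {W G : Type} [Fintype W] [AddCommGroup G] {φ : W → G}
    (hφ : Function.Injective φ)
    (h : ∀ x y, x ≠ y → ∃ z, z ≠ x ∧ z ≠ y ∧ φ x + φ y + φ z = 0) :
    (zeroSumSystem φ).IsSteiner := by
  classical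
  intro x y hxy
  obtain ⟨z, hzx, hzy, hz⟩ := h x y hxy
  have hsum : ∀ w, w ≠ x → w ≠ y → ∑ b ∈ ({x, y, w} : Finset W), φ b = φ x + φ y + φ w := by
    intro w hwx hwy
    rw [Finset.sum_insert (by simp [hxy, hwx.symm]), Finset.sum_pair hwy.symm, add_assoc]
  have hmem : ∀ B : Finset W, B ∈ (zeroSumSystem φ).blocks ↔ B.card = 3 ∧ ∑ b ∈ B, φ b = 0 := by
    intro B
    simp [zeroSumSystem]
  refine ⟨{x, y, z}, ⟨(hmem _).2 ⟨?_, by rw [hsum z hzx hzy, hz]⟩, by simp, by simp⟩, ?_⟩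
  · exact Finset.card_eq_three.2 ⟨x, y, z, hxy, hzx.symm, hzy.symm, rfl⟩
  · rintro B ⟨hB, hx, hy⟩
    obtain ⟨hc, hs⟩ := (hmem B).1 hB
    have hsub : ({x, y} : Finset W) ⊆ B := by
      intro u hu
      simp only [Finset.mem_insert, Finset.mem_singleton] at hu
      rcases hu with rfl | rfl <;> assumption
    obtain ⟨w, hw⟩ : ∃ w, B \ {x, y} = {w} := by
      refine Finset.card_eq_one.1 ?_
      rw [Finset.card_sdiff_of_subset hsub, hc, Finset.card_pair hxy]
    have hwB : w ∈ B \ {x, y} := by rw [hw]; simp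
    simp only [Finset.mem_sdiff, Finset.mem_insert, Finset.mem_singleton, not_or] at hwB
    have hBe : B = {x, y, w} := by
      ext u
      have := Finset.ext_iff.1 hw u
      simp only [Finset.mem_sdiff, Finset.mem_insert, Finset.mem_singleton] at this ⊢
      by_cases hux : u = x
      · subst hux; simp [hx]
      · by_cases huy : u = y
        · subst huy; simp [hy]
        · simpa [hux, huy] using this
    rw [hBe, hsum w hwB.2.1 hwB.2.2] at hs
    have : w = z := hφ (add_left_cancel (hs.trans hz.symm))
    rw [hBe, this]

/-- The blocks of an unavoidable configuration give linear equations in every zero-sum Steiner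
triple system with enough points. -/
theorem exists_zeroSum_of_unavoidable {V : Type*} {C : TripleSystem V} (hu : C.Unavoidable)
    (P : ℕ → Type) [∀ m, Fintype (P m)]
    (hP : ∀ m, m ≤ Fintype.card (P m)) (Q : ℕ → Type) [∀ m, AddCommGroup (Q m)]
    (φ : ∀ m, P m → Q m) (hφ : ∀ m, Function.Injective (φ m))
    (h : ∀ m x y, x ≠ y → ∃ z, z ≠ x ∧ z ≠ y ∧ φ m x + φ m y + φ m z = 0) :
    ∃ m, ∃ f : V → Q m, Function.Injective f ∧
      ∀ x y z, IsBlock C.blocks x y z → f x + f y + f z = 0 := by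
  classical
  obtain ⟨n₀, hn₀⟩ := hu
  obtain ⟨f, hf⟩ := hn₀ _ (hP n₀) (P n₀) rfl _ (zeroSumSystem_isSteiner (hφ n₀) (h n₀))
  refine ⟨n₀, fun v => φ n₀ (f v), (hφ n₀).comp f.injective, ?_⟩
  rintro x y z ⟨hxy, hyz, hxz, B, hB, hx, hy, hz⟩
  have hBe : B = {x, y, z} := by
    symm
    refine Finset.eq_of_subset_of_card_le ?_ ?_
    · intro u hu
      simp only [Finset.mem_insert, Finset.mem_singleton] at hu
      rcases hu with rfl | rfl | rfl <;> assumption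
    · rw [C.card_block B hB, Finset.card_eq_three.2 ⟨x, y, z, hxy, hxz, hyz, rfl⟩]
  have h1 := (Finset.mem_filter.1 (hf B hB)).2.2
  rw [Finset.sum_map, hBe, Finset.sum_insert (by simp [hxy, hxz]), Finset.sum_pair hyz] at h1
  rw [add_assoc]
  exact h1

/-- In an unavoidable configuration no block joins two non-corner points of a triangle: in
projective spaces over the field with two elements the third point of such a block is the third
non-corner point of the triangle, and in affine spaces over the field with three elements this
does not happen. -/
theorem not_isBlock_sides_of_unavoidable {V : Type*} {C : TripleSystem V}
    (hu : C.Unavoidable) {x y z x' y' z' s : V} (ht : IsTriangle C.blocks x y z x' y' z')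
    (hs : IsBlock C.blocks y' z' s) : False := by
  have hsx : s = x' := by
    obtain ⟨m, f, hf, hb⟩ := exists_zeroSum_of_unavoidable hu
      (fun m => {v : Fin (m + 1) → ZMod 2 // v ≠ 0})
      (fun m => by
        rw [Fintype.card_subtype_compl, Fintype.card_fun, ZMod.card, Fintype.card_fin,
          Fintype.card_subtype_eq]
        have := Nat.lt_two_pow_self (n := m)
        rw [pow_succ]
        omega)
      (fun m => Fin (m + 1) → ZMod 2) (fun m v => v.1) (fun m => Subtype.val_injective)
      (by
        rintro m ⟨x, hx⟩ ⟨y, hy⟩ hxy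
        have two : (2 : Fin (m + 1) → ZMod 2) = 0 := by ext; exact (by decide : (2 : ZMod 2) = 0)
        refine ⟨⟨x + y, fun h => hxy (Subtype.ext ?_)⟩, ?_, ?_, ?_⟩
        · linear_combination h - y * two
        · intro h
          have := congrArg Subtype.val h
          exact hy (by linear_combination this)
        · intro h
          have := congrArg Subtype.val h
          exact hx (by linear_combination this)
        · linear_combination (x + y) * two)
    have two : (2 : Fin (m + 1) → ZMod 2) = 0 := by ext; exact (by decide : (2 : ZMod 2) = 0)
    apply hf
    linear_combination hb _ _ _ hs - hb _ _ _ ht.block_x - hb _ _ _ ht.block_y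
      - hb _ _ _ ht.block_z + (f x + f y + f z) * two
  subst hsx
  obtain ⟨m, f, hf, hb⟩ := exists_zeroSum_of_unavoidable hu
    (fun m => Fin m → ZMod 3)
    (fun m => by
      rw [Fintype.card_fun, ZMod.card, Fintype.card_fin]
      exact (Nat.lt_pow_self (by norm_num)).le)
    (fun m => Fin m → ZMod 3) (fun m v => v) (fun m => Function.injective_id)
    (by
      intro m x y hxy
      have three : (3 : Fin m → ZMod 3) = 0 := by ext; exact (by decide : (3 : ZMod 3) = 0)
      refine ⟨-(x + y), fun h => hxy ?_, fun h => hxy ?_, by ring⟩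
      · linear_combination h + x * three
      · linear_combination -h - y * three)
  have three : (3 : Fin m → ZMod 3) = 0 := by ext; exact (by decide : (3 : ZMod 3) = 0)
  refine ht.ne (hf ?_)
  linear_combination hb _ _ _ hs - hb _ _ _ ht.block_x - hb _ _ _ ht.block_y
      - 2 * hb _ _ _ ht.block_z + (f x + f y + f z) * three

/-- A block joining a corner of a triangle to the opposite point completes a sail. -/
theorem contains_sail_of_isBlock {V : Type*} {C : TripleSystem V} (hC : C.IsConfiguration)
    {x y z x' y' z' s : V} (ht : IsTriangle C.blocks x y z x' y' z')
    (hs : IsBlock C.blocks x x' s) : C.Contains TripleSystem.sail := by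
  have hH := hC.isLinearFamily
  have hnd : [x, z', y, x', z, y', s].Nodup := by
    have hnd := ht.nodup hH
    obtain ⟨hx, hy, hz, hne⟩ := ht
    have u : ∀ a b c d, IsBlock C.blocks a b c → IsBlock C.blocks a b d → c = d :=
      fun a b c d h h' => h.unique hH h'
    have s : ∀ a b c, IsBlock C.blocks a b c → IsBlock C.blocks b a c := fun a b c h => h.swap
    have r : ∀ a b c, IsBlock C.blocks a b c → IsBlock C.blocks a c b :=
      fun a b c h => h.swap_right
    have n : ∀ a b c, IsBlock C.blocks a b c → a ≠ b := fun a b c h => h.1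
    simp only [List.nodup_cons, List.mem_cons, List.not_mem_nil, not_or, not_false_eq_true,
      List.nodup_nil, and_true, or_false] at hnd ⊢
    refine ⟨⟨?_, ?_, ?_, ?_, ?_, ?_⟩, ⟨?_, ?_, ?_, ?_, ?_⟩, ⟨?_, ?_, ?_, ?_⟩, ⟨?_, ?_, ?_⟩,
      ⟨?_, ?_⟩, ?_⟩ <;> grind
  have hmem : ∀ a b c : Fin 7, ∀ f : Fin 7 ↪ V, a ≠ b → b ≠ c → a ≠ c →
      IsBlock C.blocks (f a) (f b) (f c) → ({a, b, c} : Finset (Fin 7)).map f ∈ C.blocks := by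
    rintro a b c f hab hbc hac ⟨-, -, -, B, hB, ha, hb, hc⟩
    have : ({a, b, c} : Finset (Fin 7)).map f = B := by
      refine Finset.eq_of_subset_of_card_le ?_ ?_
      · intro u hu
        obtain ⟨k, hk, rfl⟩ := Finset.mem_map.1 hu
        simp only [Finset.mem_insert, Finset.mem_singleton] at hk
        rcases hk with rfl | rfl | rfl <;> assumption
      · rw [C.card_block B hB, Finset.card_map,
          Finset.card_eq_three.2 ⟨a, b, c, hab, hac, hbc, rfl⟩]
    rwa [this]
  refine ⟨⟨![x, z', y, x', z, y', s], injective_of_nodup_ofFn hnd⟩, ?_⟩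
  intro B hB
  simp only [TripleSystem.sail, Finset.mem_insert, Finset.mem_singleton] at hB
  rcases hB with rfl | rfl | rfl | rfl
  · exact hmem _ _ _ _ (by decide) (by decide) (by decide) ht.block_z.swap_right
  · exact hmem _ _ _ _ (by decide) (by decide) (by decide) ht.block_x.swap_right
  · exact hmem _ _ _ _ (by decide) (by decide) (by decide) ht.block_y.rot
  · exact hmem _ _ _ _ (by decide) (by decide) (by decide) hs

theorem triangleSparse_of_unavoidable {V : Type*} {C : TripleSystem V} (hC : C.IsConfiguration)
    (hu : C.Unavoidable) (hsail : ¬ C.Contains TripleSystem.sail) :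
    TriangleSparse C.blocks := by
  have hH := hC.isLinearFamily
  intro v hv E hE i j hij hi hj
  have hinj : Function.Injective v := injective_of_nodup_ofFn (hv.nodup hH)
  have lies : ∀ a b c : Fin 6, IsBlock C.blocks (v a) (v b) (v c) → (i = a ∨ i = b ∨ i = c) →
      (j = a ∨ j = b ∨ j = c) → LiesIn E (v a) (v b) (v c) := by
    rintro a b c ⟨h1, h2, h3, B, hB, ha, hb, hc⟩ hia hja
    have hiB : v i ∈ B := by rcases hia with rfl | rfl | rfl <;> assumption
    have hjB : v j ∈ B := by rcases hja with rfl | rfl | rfl <;> assumption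
    obtain rfl := hH.eq_of_mem _ _ (hinj.ne hij) E hE B hB hi hj hiB hjB
    exact fun u hu => (hH.mem_iff hE h1 h2 h3 ha hb hc u).1 hu
  obtain ⟨s, -, hs, -⟩ := hH.exists_third hE hi hj (hinj.ne hij)
  have hv₁ := hv.rot hH
  have hv₂ := hv₁.rot hH
  by_cases h1 : (i = 1 ∨ i = 2 ∨ i = 3) ∧ (j = 1 ∨ j = 2 ∨ j = 3)
  · exact Or.inl (lies _ _ _ hv.block_x h1.1 h1.2)
  by_cases h2 : (i = 0 ∨ i = 2 ∨ i = 4) ∧ (j = 0 ∨ j = 2 ∨ j = 4)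
  · exact Or.inr (Or.inl (lies _ _ _ hv.block_y h2.1 h2.2))
  by_cases h3 : (i = 0 ∨ i = 1 ∨ i = 5) ∧ (j = 0 ∨ j = 1 ∨ j = 5)
  · exact Or.inr (Or.inr (lies _ _ _ hv.block_z h3.1 h3.2))
  exfalso
  fin_cases i <;> fin_cases j <;> first
    | exact hij rfl
    | exact h1 (by decide)
    | exact h2 (by decide)
    | exact h3 (by decide)
    | exact hsail (contains_sail_of_isBlock hC hv hs)
    | exact hsail (contains_sail_of_isBlock hC hv hs.swap)
    | exact hsail (contains_sail_of_isBlock hC hv₁ hs)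
    | exact hsail (contains_sail_of_isBlock hC hv₁ hs.swap)
    | exact hsail (contains_sail_of_isBlock hC hv₂ hs)
    | exact hsail (contains_sail_of_isBlock hC hv₂ hs.swap)
    | exact not_isBlock_sides_of_unavoidable hu hv hs
    | exact not_isBlock_sides_of_unavoidable hu hv hs.swap
    | exact not_isBlock_sides_of_unavoidable hu hv₁ hs
    | exact not_isBlock_sides_of_unavoidable hu hv₁ hs.swap
    | exact not_isBlock_sides_of_unavoidable hu hv₂ hs
    | exact not_isBlock_sides_of_unavoidable hu hv₂ hs.swap

end Avoiding

/-! ### The most frequent colour class -/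

section Ramsey

open Classical in
/-- Discarding few members of a family leaves one in which all covered points have large
degree. -/
theorem exists_subset_min_degree {W : Type} [Fintype W] (H : Finset (Finset W)) (N : ℕ) :
    ∃ H' ⊆ H, (∀ v, (∃ B ∈ H', v ∈ B) → N ≤ (H'.filter fun B => v ∈ B).card) ∧
      H.card ≤ H'.card + N * Fintype.card W := by
  -- take `H'` maximal for the following weight, which pays `N` for each uncovered point
  let w : Finset (Finset W) → ℕ := fun K =>
    K.card + N * (Finset.univ.filter fun v => ¬ ∃ B ∈ K, v ∈ B).card
  obtain ⟨H', hH', hmax⟩ := Finset.exists_max_image H.powerset w ⟨H, Finset.mem_powerset_self H⟩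
  rw [Finset.mem_powerset] at hH'
  refine ⟨H', hH', ?_, ?_⟩
  · rintro v ⟨B, hB, hv⟩
    by_contra! hlt
    have h1 := hmax (H'.filter fun B => v ∉ B)
      (Finset.mem_powerset.2 ((Finset.filter_subset _ _).trans hH'))
    have h2 := Finset.card_filter_add_card_filter_not (s := H') (fun B => v ∈ B)
    have h3 : (Finset.univ.filter fun u => ¬ ∃ B ∈ H', u ∈ B).card + 1 ≤
        (Finset.univ.filter fun u => ¬ ∃ B ∈ H'.filter fun B => v ∉ B, u ∈ B).card := by
      rw [← Finset.card_insert_of_notMem (a := v) (by simp; exact ⟨B, hB, hv⟩)]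
      refine Finset.card_le_card fun u hu => ?_
      rw [Finset.mem_insert, Finset.mem_filter] at hu
      refine Finset.mem_filter.2 ⟨Finset.mem_univ _, ?_⟩
      rintro ⟨K, hK, huK⟩
      obtain ⟨hK1, hK2⟩ := Finset.mem_filter.1 hK
      rcases hu with rfl | ⟨-, hu⟩
      · exact hK2 huK
      · exact hu ⟨K, hK1, huK⟩
    have h4 := Nat.mul_le_mul_left N h3
    simp only [w] at h1
    rw [Nat.mul_add] at h4
    omega
  · have h1 := hmax H (Finset.mem_powerset_self H)
    have h2 : N * (Finset.univ.filter fun v => ¬ ∃ B ∈ H', v ∈ B).card ≤ N * Fintype.card W :=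
      Nat.mul_le_mul_left _ (Finset.card_le_univ _)
    simp only [w] at h1
    omega

theorem TripleSystem.IsSteiner.card_sq_le {W : Type} [Fintype W] {S : TripleSystem W}
    (hS : S.IsSteiner) : Fintype.card W ^ 2 ≤ 6 * S.blocks.card + Fintype.card W := by
  classical
  have h1 : (Finset.univ : Finset W).offDiag ⊆ S.blocks.biUnion fun B => B.offDiag := by
    rintro ⟨x, y⟩ h
    obtain ⟨-, -, hxy⟩ := Finset.mem_offDiag.1 h
    obtain ⟨B, ⟨hB, hx, hy⟩, -⟩ := hS x y hxy
    exact Finset.mem_biUnion.2 ⟨B, hB, Finset.mem_offDiag.2 ⟨hx, hy, hxy⟩⟩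
  have h2 := (Finset.card_le_card h1).trans (Finset.card_biUnion_le_card_mul _ _ 6 fun B hB => by
    rw [Finset.offDiag_card, S.card_block B hB])
  rw [Finset.offDiag_card, Finset.card_univ] at h2
  rw [sq]
  omega

/-- A configuration whose blocks embed into all large dense linear families of large minimum
degree is Ramsey for any number of colours: the most frequent colour class is dense. -/
theorem TripleSystem.IsConfiguration.isRamsey {V : Type*} {C : TripleSystem V}
    (hC : C.IsConfiguration) (hd : IsDenseUnavoidable C.blocks) {t : ℕ} (ht : 1 ≤ t) :
    C.IsRamsey t := by
  classical
  have ht' : (0 : ℝ) < t := by exact_mod_cast ht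
  obtain ⟨N, hN⟩ := hd (1 / (24 * t)) (by positivity)
  refine ⟨24 * t * N + N + 2, fun n hn W _ hW S hS c => ?_⟩
  subst hW
  let Hc : Fin t → Finset (Finset W) := fun i => S.blocks.filter fun B => ∃ h, c ⟨B, h⟩ = i
  have hsub : ∀ i, Hc i ⊆ S.blocks := fun i => Finset.filter_subset _ _
  obtain ⟨i, hi⟩ : ∃ i, S.blocks.card ≤ t * (Hc i).card := by
    by_contra! hcon
    have h1 : S.blocks ⊆ Finset.univ.biUnion Hc := fun B hB =>
      Finset.mem_biUnion.2 ⟨c ⟨B, hB⟩, Finset.mem_univ _, Finset.mem_filter.2 ⟨hB, hB, rfl⟩⟩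
    have h2 := (Finset.card_le_card h1).trans Finset.card_biUnion_le
    have h3 : ∑ i, t * (Hc i).card < ∑ _i : Fin t, S.blocks.card :=
      Finset.sum_lt_sum_of_nonempty ⟨⟨0, ht⟩, Finset.mem_univ _⟩ fun i _ => hcon i
    rw [← Finset.mul_sum, Finset.sum_const, Finset.card_univ, Fintype.card_fin, smul_eq_mul] at h3
    exact absurd (lt_of_mul_lt_mul_left h3 (Nat.zero_le t)) (not_lt.2 h2)
  obtain ⟨H', hH', hdeg, hcard⟩ := exists_subset_min_degree (Hc i) N
  have hlin : IsLinearFamily H' := by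
    refine ⟨fun B hB => S.card_block B (hsub i (hH' hB)), fun x y hxy B₁ h₁ B₂ h₂ a b c d => ?_⟩
    exact (hS x y hxy).unique ⟨hsub i (hH' h₁), a, b⟩ ⟨hsub i (hH' h₂), c, d⟩
  obtain ⟨f, hf, hfB⟩ := hN W H' (by omega) hlin (fun v hv => hdeg v hv) (by
    -- `n ^ 2 ≤ 2 (n ^ 2 - n) ≤ 12 t (|H'| + N n)` and `12 t N n ≤ n ^ 2 / 2`
    have h1 := hS.card_sq_le
    set n := Fintype.card W
    have h2 : n ^ 2 ≤ 6 * (t * (H'.card + N * n)) + n :=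
      h1.trans (by gcongr; exact hi.trans (Nat.mul_le_mul_left _ hcard))
    have h3 : ((n : ℝ)) ^ 2 ≤ 6 * (t * (H'.card + N * n)) + n := by exact_mod_cast h2
    have h4 : 24 * (t : ℝ) * N + N + 2 ≤ n := by exact_mod_cast hn
    have h5 : (0 : ℝ) ≤ N := by positivity
    have h6 : (24 * (t : ℝ) * N + 2) * n ≤ (n : ℝ) ^ 2 := by nlinarith
    have h7 : 2 * (n : ℝ) ≤ (n : ℝ) ^ 2 := by
      have : (0 : ℝ) ≤ 24 * (t : ℝ) * N * n := by positivity
      linarith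
    rw [div_mul_eq_mul_div, one_mul, div_le_iff₀ (by positivity)]
    linarith)
  have hinj : Function.Injective f := fun x y hxy => hf (hC.covered x) (hC.covered y) hxy
  refine ⟨i, ⟨f, hinj⟩, fun B hB => ?_⟩
  obtain ⟨B', hB', hBB'⟩ := hfB B hB
  have hmap : B.map ⟨f, hinj⟩ = B' := by
    refine Finset.eq_of_subset_of_card_le (fun u hu => ?_) ?_
    · obtain ⟨v, hv, rfl⟩ := Finset.mem_map.1 hu
      exact hBB' v hv
    · rw [Finset.card_map, C.card_block B hB, hlin.card_eq B' hB']
  rw [hmap]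
  exact (Finset.mem_filter.1 (hH' hB')).2

end Ramsey

theorem mainTheorem4 {V : Type*} (C : TripleSystem V) (hC : C.IsConfiguration)
    (hunav : C.Unavoidable) (hcard : C.blocks.card ≤ 5)
    (hsail : ¬ C.Contains TripleSystem.sail) (t : ℕ) (ht : 1 ≤ t) :
    C.IsRamsey t :=
  hC.isRamsey (TriangleSparse.isDenseUnavoidable _ rfl hC.isLinearFamily hcard
    (triangleSparse_of_unavoidable hC hunav hsail)) ht
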